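/- Let $g>2$ and let $f\in\mathbb C[x]$ be a polynomial of degree $2g+1$ or $2g+2$ with distinct roots. Let $X$ be the compact hyperelliptic curve of genus $g$ obtained by gluing the affine curves $y^2=f(x)$ and $w^2=z^{2g+2}f(1/z)$ along $z=1/x$, $w=y/x^{g+1}$, and let $Z\subset X$ be its set of Weierstrass points, i.e. the points with $y=0$ (respectively $w=0$). Let $\omega_1,\dots,\omega_g$ be any basis of the space of holomorphic one-forms on $X$, and let $ds^2=\sum_{i=1}^g\omega_i\otimes\overline{\omega_i}$ be the canonical metric, i.e. the pull-back of the standard flat metric on $\operatorname{Jac}(X)$ under the Abel–Jacobi map defined by $(\omega_i)$. Let $K$ be its Gaussian curvature and $\Delta$ its Laplace–Beltrami operator; so if $ds^2=\rho\,d\zeta\otimes d\bar\zeta$ in a local coordinate $\zeta$, then $\Delta=\frac4\rho\frac{\partial^2}{\partial\zeta\partial\bar\zeta}$ and $K=-\frac12\Delta\log\rho$. Then $K<0$ on $X\setminus Z$, the function $u=\log(-K)$ is smooth on $X\setminus Z$, and we put $$\Phi=\Delta\log(-K)+6(-K)\quad\text{on } X\setminus Z.$$ 1. $\Phi$ does not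 vanish identically on $X\setminus Z$. 2. There is an invertible matrix $A=(a_{ij})\in\mathbb C^{g\times g}$ with $\omega_i=\sum_{j=1}^g a_{ji}\,x^{j-1}\,dx/y$ for $1\le i\le g$ (where $y\neq0$). Put $C=AA^*$, i.e. $c_{kj}=\sum_i a_{ki}\overline{a_{ji}}$, and let $C_k=(c_{ij})_{1\le i,j\le k}$. Then at every point $P\in X\setminus Z$ with $x(P)=0$ (such points exist if and only if $f(0)\ne0$), $$\Phi(P)=\frac{16\,|f(0)|\det C_3}{(\det C_2)^2}>0 .$$ 3. The function $u=\log(-K)$ does not satisfy, in the sense of distributions on $X$, the mean field equation $\Delta u+6e^u=4\pi\sum_{P\in Z}\delta_P$, which holds when $g=2$. -/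

import Mathlib

open scoped Manifold ContDiff Polynomial
open Topology

noncomputable section

/-! ### Smooth affine curves `y² = p(x)` as Riemann surfaces -/

theorem polyContDiff (p : ℂ[X]) : ContDiff ℂ ω fun x => p.eval x := by
  simpa using p.contDiff_aeval (𝕜 := ℂ) ω

/-- Local inversion of a polynomial at a point where its derivative does not vanish. -/
theorem exists_polyLocalInverse (p : ℂ[X]) (a : ℂ) (h : p.derivative.eval a ≠ 0) :
    ∃ e : OpenPartialHomeomorph ℂ ℂ, a ∈ e.source ∧ (∀ x, e x = p.eval x) ∧
      ∀ z ∈ e.target, ContDiffAt ℂ ω e.symm z := by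
  have hs := (p.hasStrictDerivAt a).hasStrictFDerivAt_equiv h
  let e₀ := hs.toOpenPartialHomeomorph (fun x => p.eval x)
  have hopen : IsOpen {x : ℂ | p.derivative.eval x ≠ 0} :=
    isOpen_ne_fun p.derivative.continuous continuous_const
  refine ⟨e₀.restrOpen _ hopen, ⟨hs.mem_toOpenPartialHomeomorph_source, h⟩, fun x => rfl, ?_⟩
  intro z hz
  have hz' := (e₀.restrOpen _ hopen).map_target hz
  refine (e₀.restrOpen _ hopen).contDiffAt_symm_deriv (f₀' := p.derivative.eval
    ((e₀.restrOpen _ hopen).symm z)) hz'.2 hz (p.hasDerivAt _) ?_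
  exact (polyContDiff p).contDiffAt

/-- A chosen local inverse of the polynomial `p` at the point `a`, where `p'(a) ≠ 0`. -/
def polyLocalInverse (p : ℂ[X]) (a : ℂ) (h : p.derivative.eval a ≠ 0) :
    OpenPartialHomeomorph ℂ ℂ :=
  (exists_polyLocalInverse p a h).choose

theorem polyLocalInverse_mem (p : ℂ[X]) (a : ℂ) (h : p.derivative.eval a ≠ 0) :
    a ∈ (polyLocalInverse p a h).source :=
  (exists_polyLocalInverse p a h).choose_spec.1

theorem polyLocalInverse_apply (p : ℂ[X]) (a : ℂ) (h : p.derivative.eval a ≠ 0) (x : ℂ) :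
    polyLocalInverse p a h x = p.eval x :=
  (exists_polyLocalInverse p a h).choose_spec.2.1 x

theorem polyLocalInverse_contDiffAt (p : ℂ[X]) (a : ℂ) (h : p.derivative.eval a ≠ 0) (z : ℂ)
    (hz : z ∈ (polyLocalInverse p a h).target) :
    ContDiffAt ℂ ω (polyLocalInverse p a h).symm z :=
  (exists_polyLocalInverse p a h).choose_spec.2.2 z hz

theorem polyLocalInverse_symm (p : ℂ[X]) (a : ℂ) (h : p.derivative.eval a ≠ 0) (z : ℂ)
    (hz : z ∈ (polyLocalInverse p a h).target) :
    p.eval ((polyLocalInverse p a h).symm z) = z := by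
  rw [← polyLocalInverse_apply p a h]
  exact (polyLocalInverse p a h).right_inv hz

/-- The affine plane curve `{(x, y) ∈ ℂ² : y² = p(x)}`. -/
@[ext]
structure AffineCurve (p : ℂ[X]) where
  /-- The coordinate function `x`. -/
  x : ℂ
  /-- The coordinate function `y`. -/
  y : ℂ
  eqn : y ^ 2 = p.eval x

namespace AffineCurve

/-- The topology of the curve is the one induced from `ℂ²`. -/
instance (p : ℂ[X]) : TopologicalSpace (AffineCurve p) :=
  TopologicalSpace.induced (fun q => (q.x, q.y)) inferInstance

theorem isInducing_coords {p : ℂ[X]} :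
    IsInducing (fun q : AffineCurve p => (q.x, q.y)) := ⟨rfl⟩

theorem continuous_x {p : ℂ[X]} : Continuous (x : AffineCurve p → ℂ) :=
  continuous_fst.comp isInducing_coords.continuous

theorem continuous_y {p : ℂ[X]} : Continuous (y : AffineCurve p → ℂ) :=
  continuous_snd.comp isInducing_coords.continuous

theorem deriv_sq_ne_zero {a : ℂ} (h : a ≠ 0) :
    (Polynomial.X ^ 2 : ℂ[X]).derivative.eval a ≠ 0 := by
  simpa using h

open Classical in
/-- The inverse of the chart `x` near a point with `y ≠ 0`: `t ↦ (t, √p(t))`. -/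
def xChartInv {p : ℂ[X]} (q : AffineCurve p) (h : q.y ≠ 0) (t : ℂ) : AffineCurve p :=
  if ht : p.eval t ∈ (polyLocalInverse (Polynomial.X ^ 2) q.y (deriv_sq_ne_zero h)).target then
    ⟨t, (polyLocalInverse (Polynomial.X ^ 2) q.y (deriv_sq_ne_zero h)).symm (p.eval t), by
      simpa using polyLocalInverse_symm _ _ (deriv_sq_ne_zero h) _ ht⟩
  else q

open Classical in
/-- The inverse of the chart `y` near a point with `p'(x) ≠ 0`: `t ↦ (p⁻¹(t²), t)`. -/
def yChartInv {p : ℂ[X]} (q : AffineCurve p) (h : p.derivative.eval q.x ≠ 0) (t : ℂ) :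
    AffineCurve p :=
  if ht : t ^ 2 ∈ (polyLocalInverse p q.x h).target then
    ⟨(polyLocalInverse p q.x h).symm (t ^ 2), t,
      (polyLocalInverse_symm _ _ h _ ht).symm⟩
  else q

theorem xChartInv_x {p : ℂ[X]} (q : AffineCurve p) (h : q.y ≠ 0) {t : ℂ} (ht : p.eval t ∈
    (polyLocalInverse (Polynomial.X ^ 2) q.y (deriv_sq_ne_zero h)).target) :
    (xChartInv q h t).x = t := by
  unfold xChartInv
  rw [dif_pos ht]

theorem xChartInv_y {p : ℂ[X]} (q : AffineCurve p) (h : q.y ≠ 0) {t : ℂ} (ht : p.eval t ∈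
    (polyLocalInverse (Polynomial.X ^ 2) q.y (deriv_sq_ne_zero h)).target) :
    (xChartInv q h t).y =
      (polyLocalInverse (Polynomial.X ^ 2) q.y (deriv_sq_ne_zero h)).symm (p.eval t) := by
  unfold xChartInv
  rw [dif_pos ht]

theorem yChartInv_x {p : ℂ[X]} (q : AffineCurve p) (h : p.derivative.eval q.x ≠ 0) {t : ℂ}
    (ht : t ^ 2 ∈ (polyLocalInverse p q.x h).target) :
    (yChartInv q h t).x = (polyLocalInverse p q.x h).symm (t ^ 2) := by
  unfold yChartInv
  rw [dif_pos ht]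

theorem yChartInv_y {p : ℂ[X]} (q : AffineCurve p) (h : p.derivative.eval q.x ≠ 0) {t : ℂ}
    (ht : t ^ 2 ∈ (polyLocalInverse p q.x h).target) :
    (yChartInv q h t).y = t := by
  unfold yChartInv
  rw [dif_pos ht]

theorem continuousOn_mk {p : ℂ[X]} {f : ℂ → AffineCurve p} {s : Set ℂ}
    (hx : ContinuousOn (fun t => (f t).x) s) (hy : ContinuousOn (fun t => (f t).y) s) :
    ContinuousOn f s :=
  isInducing_coords.continuousOn_iff.2 (hx.prodMk hy)

/-- The local coordinate `x` near a point with `y ≠ 0`. -/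
def xChart {p : ℂ[X]} (q : AffineCurve p) (h : q.y ≠ 0) :
    OpenPartialHomeomorph (AffineCurve p) ℂ where
  toFun := x
  invFun := xChartInv q h
  source := y ⁻¹' (polyLocalInverse (Polynomial.X ^ 2) q.y (deriv_sq_ne_zero h)).source
  target := (fun t => p.eval t) ⁻¹'
    (polyLocalInverse (Polynomial.X ^ 2) q.y (deriv_sq_ne_zero h)).target
  map_source' := by
    intro r hr
    have := (polyLocalInverse (Polynomial.X ^ 2) q.y (deriv_sq_ne_zero h)).map_source hr
    rw [polyLocalInverse_apply] at this
    simpa [← r.eqn] using this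
  map_target' := by
    intro t ht
    rw [Set.mem_preimage, xChartInv_y q h ht]
    exact (polyLocalInverse (Polynomial.X ^ 2) q.y (deriv_sq_ne_zero h)).map_target ht
  left_inv' := by
    intro r hr
    have h1 := (polyLocalInverse (Polynomial.X ^ 2) q.y (deriv_sq_ne_zero h)).map_source hr
    have h2 := (polyLocalInverse (Polynomial.X ^ 2) q.y (deriv_sq_ne_zero h)).left_inv hr
    rw [polyLocalInverse_apply] at h1 h2
    simp only [Polynomial.eval_pow, Polynomial.eval_X, r.eqn] at h1 h2
    exact AffineCurve.ext (xChartInv_x q h h1) ((xChartInv_y q h h1).trans h2)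
  right_inv' := fun t ht => xChartInv_x q h ht
  open_source := (OpenPartialHomeomorph.open_source _).preimage continuous_y
  open_target := (OpenPartialHomeomorph.open_target _).preimage p.continuous
  continuousOn_toFun := continuous_x.continuousOn
  continuousOn_invFun := by
    refine continuousOn_mk ?_ ?_
    · exact continuousOn_id.congr fun t ht => xChartInv_x q h ht
    · exact ((polyLocalInverse (Polynomial.X ^ 2) q.y
        (deriv_sq_ne_zero h)).continuousOn_symm.comp p.continuous.continuousOn
        (fun t ht => ht)).congr fun t ht => xChartInv_y q h ht

/-- The local coordinate `y` near a point with `p'(x) ≠ 0`. -/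
def yChart {p : ℂ[X]} (q : AffineCurve p) (h : p.derivative.eval q.x ≠ 0) :
    OpenPartialHomeomorph (AffineCurve p) ℂ where
  toFun := y
  invFun := yChartInv q h
  source := x ⁻¹' (polyLocalInverse p q.x h).source
  target := (fun t => t ^ 2) ⁻¹' (polyLocalInverse p q.x h).target
  map_source' := by
    intro r hr
    have := (polyLocalInverse p q.x h).map_source hr
    rw [polyLocalInverse_apply] at this
    simpa [r.eqn] using this
  map_target' := by
    intro t ht
    rw [Set.mem_preimage, yChartInv_x q h ht]
    exact (polyLocalInverse p q.x h).map_target ht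
  left_inv' := by
    intro r hr
    have h1 := (polyLocalInverse p q.x h).map_source hr
    have h2 := (polyLocalInverse p q.x h).left_inv hr
    rw [polyLocalInverse_apply, ← r.eqn] at h1 h2
    exact AffineCurve.ext ((yChartInv_x q h h1).trans h2) (yChartInv_y q h h1)
  right_inv' := fun t ht => yChartInv_y q h ht
  open_source := (OpenPartialHomeomorph.open_source _).preimage continuous_x
  open_target := (OpenPartialHomeomorph.open_target _).preimage (continuous_pow 2)
  continuousOn_toFun := continuous_y.continuousOn
  continuousOn_invFun := by
    refine continuousOn_mk ?_ ?_
    · exact ((polyLocalInverse p q.x h).continuousOn_symm.comp (continuous_pow 2).continuousOn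
        (fun t ht => ht)).congr fun t ht => yChartInv_x q h ht
    · exact continuousOn_id.congr fun t ht => yChartInv_y q h ht

/-- The curve `y² = p(x)` is nonsingular: `p` has no multiple root. -/
def Nonsingular (p : ℂ[X]) : Prop := ∀ t, p.eval t = 0 → p.derivative.eval t ≠ 0

theorem Nonsingular.deriv_ne {p : ℂ[X]} (hp : Nonsingular p) (q : AffineCurve p)
    (h : ¬ q.y ≠ 0) : p.derivative.eval q.x ≠ 0 :=
  hp _ (by rw [← q.eqn, not_not.1 h]; simp)

open Classical in
/-- The preferred chart at `q`: the coordinate `x` if `y(q) ≠ 0`, and `y` otherwise. -/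
def chart {p : ℂ[X]} (hp : Nonsingular p) (q : AffineCurve p) :
    OpenPartialHomeomorph (AffineCurve p) ℂ :=
  if h : q.y ≠ 0 then xChart q h else yChart q (hp.deriv_ne q h)

theorem mem_chart_source {p : ℂ[X]} (hp : Nonsingular p) (q : AffineCurve p) :
    q ∈ (chart hp q).source := by
  unfold chart
  split_ifs with h
  · exact polyLocalInverse_mem _ _ (deriv_sq_ne_zero h)
  · exact polyLocalInverse_mem _ _ (hp.deriv_ne q h)

theorem chart_apply {p : ℂ[X]} (hp : Nonsingular p) (q : AffineCurve p) :
    (∀ r, chart hp q r = r.x) ∨ (∀ r, chart hp q r = r.y) := by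
  unfold chart
  split_ifs with h
  · exact Or.inl fun r => rfl
  · exact Or.inr fun r => rfl

theorem contDiffAt_chart_symm {p : ℂ[X]} (hp : Nonsingular p) (q : AffineCurve p) {t : ℂ}
    (ht : t ∈ (chart hp q).target) :
    ContDiffAt ℂ ω (fun s => ((chart hp q).symm s).x) t ∧
      ContDiffAt ℂ ω (fun s => ((chart hp q).symm s).y) t := by
  have hev := (chart hp q).open_target.mem_nhds ht
  unfold chart at ht hev ⊢
  split_ifs at ht hev ⊢ with h
  · refine ⟨?_, ?_⟩
    · exact (contDiffAt_id (n := ω)).congr_of_eventuallyEq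
        (Filter.mem_of_superset hev fun s hs => xChartInv_x q h hs)
    · have hc := ContDiffAt.comp (f := fun s => p.eval s) t
        (polyLocalInverse_contDiffAt _ _ (deriv_sq_ne_zero h) _ ht) (polyContDiff p).contDiffAt
      exact hc.congr_of_eventuallyEq
        (Filter.mem_of_superset hev fun s hs => xChartInv_y q h hs)
  · have h' := hp.deriv_ne q h
    refine ⟨?_, ?_⟩
    · have hc := ContDiffAt.comp (f := fun s : ℂ => s ^ 2) t
        (polyLocalInverse_contDiffAt _ _ h' _ ht)
        (contDiff_id.pow 2 : ContDiff ℂ ω fun s : ℂ => s ^ 2).contDiffAt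
      exact hc.congr_of_eventuallyEq
        (Filter.mem_of_superset hev fun s hs => yChartInv_x q h' hs)
    · exact (contDiffAt_id (n := ω)).congr_of_eventuallyEq
        (Filter.mem_of_superset hev fun s hs => yChartInv_y q h' hs)

end AffineCurve

/-! ### The compact hyperelliptic curve -/

/-- A polynomial `f` of degree `2g + 1` or `2g + 2` with distinct roots, the datum that defines
the hyperelliptic curve `y² = f(x)` of genus `g`. -/
structure HyperellipticDatum (g : ℕ) where
  f : ℂ[X]
  separable : f.Separable
  natDegree_eq : f.natDegree = 2 * g + 1 ∨ f.natDegree = 2 * g + 2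

namespace HyperellipticDatum

/-- The polynomial `z ^ (2g + 2) f(1/z)`. -/
def fInf {g : ℕ} (D : HyperellipticDatum g) : ℂ[X] := D.f.reflect (2 * g + 2)

theorem natDegree_le {g : ℕ} (D : HyperellipticDatum g) : D.f.natDegree ≤ 2 * g + 2 := by
  rcases D.natDegree_eq with h | h <;> omega

theorem eval_f_inv {g : ℕ} (D : HyperellipticDatum g) {t : ℂ} (ht : t ≠ 0) :
    D.f.eval t⁻¹ = t⁻¹ ^ (2 * g + 2) * D.fInf.eval t := by
  let _ : Invertible t⁻¹ := invertibleOfNonzero (inv_ne_zero ht)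
  have := Polynomial.eval₂_reflect_mul_pow (RingHom.id ℂ) t⁻¹ (2 * g + 2) D.f D.natDegree_le
  simp only [invOf_eq_inv, inv_inv, Polynomial.eval₂_id] at this
  rw [← this, fInf, mul_comm]

theorem eval_fInf {g : ℕ} (D : HyperellipticDatum g) {t : ℂ} (ht : t ≠ 0) :
    D.fInf.eval t = t ^ (2 * g + 2) * D.f.eval t⁻¹ := by
  rw [D.eval_f_inv ht, ← mul_assoc, ← mul_pow, mul_inv_cancel₀ ht, one_pow, one_mul]

theorem eval_fInf_inv {g : ℕ} (D : HyperellipticDatum g) {t : ℂ} (ht : t ≠ 0) :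
    D.fInf.eval t⁻¹ = t⁻¹ ^ (2 * g + 2) * D.f.eval t := by
  rw [D.eval_fInf (inv_ne_zero ht), inv_inv]

theorem nonsingular_f {g : ℕ} (D : HyperellipticDatum g) : AffineCurve.Nonsingular D.f := by
  intro t ht
  simpa using D.separable.eval₂_derivative_ne_zero (RingHom.id ℂ) (x := t) (by simpa using ht)

theorem nonsingular_fInf {g : ℕ} (D : HyperellipticDatum g) :
    AffineCurve.Nonsingular D.fInf := by
  intro t ht
  by_cases h0 : t = 0
  · subst h0
    have hN : D.f.coeff (2 * g + 2) = 0 := by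
      rw [← Polynomial.coeff_zero_eq_eval_zero, fInf, Polynomial.coeff_reflect,
        Polynomial.revAt_zero] at ht
      exact ht
    have hf0 : D.f ≠ 0 := D.separable.ne_zero
    have hd : D.f.natDegree = 2 * g + 1 := by
      rcases D.natDegree_eq with h | h
      · exact h
      · rw [← h, Polynomial.coeff_natDegree, Polynomial.leadingCoeff_eq_zero] at hN
        exact absurd hN hf0
    rw [← Polynomial.coeff_zero_eq_eval_zero, Polynomial.coeff_derivative, fInf,
      Polynomial.coeff_reflect, Polynomial.revAt_le (by omega)]
    have : 2 * g + 2 - (0 + 1) = D.f.natDegree := by omega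
    rw [this, Polynomial.coeff_natDegree]
    simpa using hf0
  · have hz : D.f.eval t⁻¹ = 0 := by rw [D.eval_f_inv h0, ht, mul_zero]
    have hd := D.nonsingular_f _ hz
    have h1 : HasDerivAt (fun s => D.fInf.eval s) (D.fInf.derivative.eval t) t :=
      D.fInf.hasDerivAt t
    have h2 : HasDerivAt (fun s : ℂ => s ^ (2 * g + 2) * D.f.eval s⁻¹)
        (((2 * g + 2 : ℕ) : ℂ) * t ^ (2 * g + 2 - 1) * D.f.eval t⁻¹ +
          t ^ (2 * g + 2) * (D.f.derivative.eval t⁻¹ * (-(t ^ 2)⁻¹))) t :=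
      (hasDerivAt_pow _ t).mul ((D.f.hasDerivAt t⁻¹).comp t (hasDerivAt_inv h0))
    have h3 := h2.congr_of_eventuallyEq (f₁ := fun s => D.fInf.eval s)
      (Filter.mem_of_superset (isOpen_ne.mem_nhds h0) fun s hs => D.eval_fInf hs)
    rw [h1.unique h3, hz]
    simp [h0, hd]

end HyperellipticDatum

/-- The gluing relation `z = 1/x`, `w = y / x ^ (g + 1)` between points `(x, y)` and `(z, w)` of
two affine curves, written without denominators. -/
def AffineCurve.Glued (g : ℕ) {p p' : ℂ[X]} (q : AffineCurve p) (r : AffineCurve p') : Prop :=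
  q.x * r.x = 1 ∧ r.y * q.x ^ (g + 1) = q.y

namespace AffineCurve.Glued

variable {g : ℕ} {p p' : ℂ[X]}

theorem symm {q : AffineCurve p} {r : AffineCurve p'} (h : Glued g q r) : Glued g r q := by
  refine ⟨by rw [mul_comm]; exact h.1, ?_⟩
  rw [← h.2, mul_assoc, ← mul_pow, h.1, one_pow, mul_one]

theorem x_eq {q : AffineCurve p} {r : AffineCurve p'} (h : Glued g q r) : q.x = r.x⁻¹ :=
  eq_inv_of_mul_eq_one_left h.1

theorem y_eq {q : AffineCurve p} {r : AffineCurve p'} (h : Glued g q r) :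
    q.y = r.y * r.x⁻¹ ^ (g + 1) := by
  rw [← h.x_eq, h.2]

theorem ne_zero {q : AffineCurve p} {r : AffineCurve p'} (h : Glued g q r) : r.x ≠ 0 :=
  right_ne_zero_of_mul_eq_one h.1

theorem left_unique {q q' : AffineCurve p} {r : AffineCurve p'} (h : Glued g q r)
    (h' : Glued g q' r) : q = q' :=
  AffineCurve.ext (h.x_eq.trans h'.x_eq.symm) (h.y_eq.trans h'.y_eq.symm)

theorem isOpen (hpp : ∀ t : ℂ, t ≠ 0 → p.eval t⁻¹ = t⁻¹ ^ (2 * g + 2) * p'.eval t)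
    {U : Set (AffineCurve p)} (hU : IsOpen U) :
    IsOpen {r : AffineCurve p' | ∃ q ∈ U, Glued g q r} := by
  obtain ⟨V, hV, rfl⟩ := isInducing_coords.isOpen_iff.1 hU
  have hs : IsOpen {r : AffineCurve p' | r.x ≠ 0} := isOpen_ne_fun continuous_x continuous_const
  have hc : ContinuousOn (fun r : AffineCurve p' => (r.x⁻¹, r.y * r.x⁻¹ ^ (g + 1)))
      {r : AffineCurve p' | r.x ≠ 0} := by
    have hi : ContinuousOn (fun r : AffineCurve p' => r.x⁻¹) {r : AffineCurve p' | r.x ≠ 0} :=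
      continuous_x.continuousOn.inv₀ fun r hr => hr
    exact hi.prodMk (continuous_y.continuousOn.mul (hi.pow _))
  convert hc.isOpen_inter_preimage hs hV using 1
  ext r
  constructor
  · rintro ⟨q, hq, h⟩
    refine ⟨h.ne_zero, ?_⟩
    simp only [Set.mem_preimage] at hq ⊢
    rwa [← h.x_eq, h.2]
  · rintro ⟨hr, hrV⟩
    refine ⟨⟨r.x⁻¹, r.y * r.x⁻¹ ^ (g + 1), ?_⟩, hrV, inv_mul_cancel₀ hr, rfl⟩
    rw [hpp _ hr, ← r.eqn, mul_pow, ← pow_mul]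
    ring

end AffineCurve.Glued

namespace HyperellipticDatum

variable {g : ℕ} (D : HyperellipticDatum g)

/-- The equivalence relation on `C₀ ⊔ C₀'` generated by the gluing. -/
def Rel : AffineCurve D.f ⊕ AffineCurve D.fInf → AffineCurve D.f ⊕ AffineCurve D.fInf → Prop
  | Sum.inl q, Sum.inl q' => q = q'
  | Sum.inl q, Sum.inr r => AffineCurve.Glued g q r
  | Sum.inr r, Sum.inl q => AffineCurve.Glued g q r
  | Sum.inr r, Sum.inr r' => r = r'

/-- The gluing as a setoid. -/
def setoid : Setoid (AffineCurve D.f ⊕ AffineCurve D.fInf) where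
  r := D.Rel
  iseqv :=
    { refl := by rintro (q | r) <;> exact rfl
      symm := by
        rintro (q | r) (q' | r') h
        · exact Eq.symm h
        · exact h
        · exact h
        · exact Eq.symm h
      trans := by
        rintro (a | a) (b | b) (c | c) h h' <;> simp only [Rel] at h h' ⊢
        · exact h.trans h'
        · rwa [h]
        · exact h.left_unique h'
        · rwa [← h']
        · rwa [← h']
        · exact h.symm.left_unique h'.symm
        · rwa [h]
        · exact h.trans h' }

/-- The compact hyperelliptic curve: the affine curves `y² = f(x)` and
`w² = z ^ (2g + 2) f(1/z)` glued along `z = 1/x`, `w = y / x ^ (g + 1)`. -/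
def Curve : Type := Quotient D.setoid

namespace Curve

/-- The curve carries the quotient topology. -/
instance : TopologicalSpace D.Curve :=
  inferInstanceAs (TopologicalSpace (Quotient D.setoid))

variable {D}

/-- The inclusion of the affine curve `y² = f(x)`. -/
def ofAffine (q : AffineCurve D.f) : D.Curve := Quotient.mk D.setoid (Sum.inl q)

/-- The inclusion of the affine curve `w² = z ^ (2g + 2) f(1/z)` (which contains the points at
infinity of `y² = f(x)` as its points with `z = 0`). -/
def ofInfinity (r : AffineCurve D.fInf) : D.Curve := Quotient.mk D.setoid (Sum.inr r)

theorem ofAffine_injective : Function.Injective (ofAffine : AffineCurve D.f → D.Curve) :=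
  fun _ _ h => Quotient.exact h

theorem ofInfinity_injective :
    Function.Injective (ofInfinity : AffineCurve D.fInf → D.Curve) :=
  fun _ _ h => Quotient.exact h

theorem ofAffine_eq_ofInfinity {q : AffineCurve D.f} {r : AffineCurve D.fInf} :
    ofAffine q = ofInfinity r ↔ AffineCurve.Glued g q r :=
  ⟨fun h => Quotient.exact h, fun h => Quotient.sound h⟩

theorem continuous_ofAffine : Continuous (ofAffine : AffineCurve D.f → D.Curve) :=
  continuous_quot_mk.comp continuous_inl

theorem continuous_ofInfinity : Continuous (ofInfinity : AffineCurve D.fInf → D.Curve) :=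
  continuous_quot_mk.comp continuous_inr

theorem isOpen_iff {U : Set D.Curve} :
    IsOpen U ↔ IsOpen (ofAffine ⁻¹' U) ∧ IsOpen (ofInfinity ⁻¹' U) := by
  have h1 : IsOpen U ↔ IsOpen (Quotient.mk D.setoid ⁻¹' U) :=
    (isQuotientMap_quot_mk (r := D.setoid.r)).isOpen_preimage.symm
  rw [h1, isOpen_sum_iff]
  rfl

theorem isOpenEmbedding_ofAffine :
    IsOpenEmbedding (ofAffine : AffineCurve D.f → D.Curve) := by
  refine IsOpenEmbedding.of_continuous_injective_isOpenMap continuous_ofAffine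
    ofAffine_injective fun U hU => isOpen_iff.2 ⟨?_, ?_⟩
  · rwa [Set.preimage_image_eq _ ofAffine_injective]
  · convert AffineCurve.Glued.isOpen (g := g) (p' := D.fInf) (fun t ht => D.eval_f_inv ht) hU
      using 1
    ext r
    simp [ofAffine_eq_ofInfinity]

theorem isOpenEmbedding_ofInfinity :
    IsOpenEmbedding (ofInfinity : AffineCurve D.fInf → D.Curve) := by
  refine IsOpenEmbedding.of_continuous_injective_isOpenMap continuous_ofInfinity
    ofInfinity_injective fun U hU => isOpen_iff.2 ⟨?_, ?_⟩
  · convert AffineCurve.Glued.isOpen (g := g) (p' := D.f) (fun t ht => D.eval_fInf_inv ht) hU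
      using 1
    ext q
    constructor
    · rintro ⟨r, hr, h⟩
      exact ⟨r, hr, (ofAffine_eq_ofInfinity.1 h.symm).symm⟩
    · rintro ⟨r, hr, h⟩
      exact ⟨r, hr, (ofAffine_eq_ofInfinity.2 h.symm).symm⟩
  · rwa [Set.preimage_image_eq _ ofInfinity_injective]

/-- The chart of the compact curve induced by the preferred chart of `y² = f(x)` at `q`. -/
def affineChart (q : AffineCurve D.f) : OpenPartialHomeomorph D.Curve ℂ :=
  haveI : Nonempty (AffineCurve D.f) := ⟨q⟩
  (isOpenEmbedding_ofAffine.toOpenPartialHomeomorph ofAffine).symm.trans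
    (AffineCurve.chart D.nonsingular_f q)

/-- The chart of the compact curve induced by the preferred chart of
`w² = z ^ (2g + 2) f(1/z)` at `r`. -/
def infinityChart (r : AffineCurve D.fInf) : OpenPartialHomeomorph D.Curve ℂ :=
  haveI : Nonempty (AffineCurve D.fInf) := ⟨r⟩
  (isOpenEmbedding_ofInfinity.toOpenPartialHomeomorph ofInfinity).symm.trans
    (AffineCurve.chart D.nonsingular_fInf r)

theorem affineChart_target (q : AffineCurve D.f) :
    (affineChart q).target = (AffineCurve.chart D.nonsingular_f q).target := by
  simp [affineChart]

theorem infinityChart_target (r : AffineCurve D.fInf) :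
    (infinityChart r).target = (AffineCurve.chart D.nonsingular_fInf r).target := by
  simp [infinityChart]

theorem affineChart_symm_apply (q : AffineCurve D.f) (t : ℂ) :
    (affineChart q).symm t = ofAffine ((AffineCurve.chart D.nonsingular_f q).symm t) := by
  simp [affineChart]

theorem infinityChart_symm_apply (r : AffineCurve D.fInf) (t : ℂ) :
    (infinityChart r).symm t = ofInfinity ((AffineCurve.chart D.nonsingular_fInf r).symm t) := by
  simp [infinityChart]

theorem affineChart_apply (q q' : AffineCurve D.f) :
    affineChart q (ofAffine q') = AffineCurve.chart D.nonsingular_f q q' := by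
  have : Nonempty (AffineCurve D.f) := ⟨q⟩
  simp only [affineChart, OpenPartialHomeomorph.trans_apply]
  rw [IsOpenEmbedding.toOpenPartialHomeomorph_left_inv]

theorem infinityChart_apply (r r' : AffineCurve D.fInf) :
    infinityChart r (ofInfinity r') = AffineCurve.chart D.nonsingular_fInf r r' := by
  have : Nonempty (AffineCurve D.fInf) := ⟨r⟩
  simp only [infinityChart, OpenPartialHomeomorph.trans_apply]
  rw [IsOpenEmbedding.toOpenPartialHomeomorph_left_inv]

theorem affineChart_source (q : AffineCurve D.f) :
    (affineChart q).source = ofAffine '' (AffineCurve.chart D.nonsingular_f q).source := by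
  have : Nonempty (AffineCurve D.f) := ⟨q⟩
  ext P
  simp only [affineChart, OpenPartialHomeomorph.trans_source, OpenPartialHomeomorph.symm_source,
    IsOpenEmbedding.toOpenPartialHomeomorph_target]
  constructor
  · rintro ⟨⟨q', rfl⟩, h⟩
    rw [Set.mem_preimage, IsOpenEmbedding.toOpenPartialHomeomorph_left_inv] at h
    exact ⟨q', h, rfl⟩
  · rintro ⟨q', h, rfl⟩
    refine ⟨⟨q', rfl⟩, ?_⟩
    rwa [Set.mem_preimage, IsOpenEmbedding.toOpenPartialHomeomorph_left_inv]

theorem infinityChart_source (r : AffineCurve D.fInf) :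
    (infinityChart r).source =
      ofInfinity '' (AffineCurve.chart D.nonsingular_fInf r).source := by
  have : Nonempty (AffineCurve D.fInf) := ⟨r⟩
  ext P
  simp only [infinityChart, OpenPartialHomeomorph.trans_source,
    OpenPartialHomeomorph.symm_source, IsOpenEmbedding.toOpenPartialHomeomorph_target]
  constructor
  · rintro ⟨⟨q', rfl⟩, h⟩
    rw [Set.mem_preimage, IsOpenEmbedding.toOpenPartialHomeomorph_left_inv] at h
    exact ⟨q', h, rfl⟩
  · rintro ⟨q', h, rfl⟩
    refine ⟨⟨q', rfl⟩, ?_⟩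
    rwa [Set.mem_preimage, IsOpenEmbedding.toOpenPartialHomeomorph_left_inv]

theorem exists_rep (P : D.Curve) :
    (∃ q, ofAffine q = P) ∨ (∃ r : AffineCurve D.fInf, ofInfinity r = P) := by
  induction P using Quotient.inductionOn with
  | h s => rcases s with q | r
           · exact Or.inl ⟨q, rfl⟩
           · exact Or.inr ⟨r, rfl⟩

open Classical in
/-- The preferred chart at a point of the compact curve. -/
def preferredChart (P : D.Curve) : OpenPartialHomeomorph D.Curve ℂ :=
  if h : ∃ q, ofAffine q = P then affineChart h.choose
  else infinityChart ((exists_rep P).resolve_left h).choose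

theorem mem_preferredChart_source (P : D.Curve) : P ∈ (preferredChart P).source := by
  unfold preferredChart
  split_ifs with h
  · rw [affineChart_source]
    exact ⟨_, AffineCurve.mem_chart_source _ _, h.choose_spec⟩
  · rw [infinityChart_source]
    exact ⟨_, AffineCurve.mem_chart_source _ _, ((exists_rep P).resolve_left h).choose_spec⟩

/-- The atlas of the compact curve: the coordinates `x`, `y` on `y² = f(x)` and `z`, `w` on
`w² = z ^ (2g + 2) f(1/z)`. -/
instance : ChartedSpace ℂ D.Curve where
  atlas := Set.range affineChart ∪ Set.range infinityChart
  chartAt := preferredChart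
  mem_chart_source := mem_preferredChart_source
  chart_mem_atlas := by
    intro P
    unfold preferredChart
    split_ifs with h
    · exact Or.inl ⟨_, rfl⟩
    · exact Or.inr ⟨_, rfl⟩

/-- A function which agrees at each point with one of the two coordinates of a curve whose
coordinates depend analytically on the parameter. -/
theorem contDiffAt_coord {p : ℂ[X]} {F : AffineCurve p → ℂ}
    (hF : (∀ r, F r = r.x) ∨ (∀ r, F r = r.y)) {c : ℂ → AffineCurve p} {t : ℂ}
    (hx : ContDiffAt ℂ ω (fun s => (c s).x) t) (hy : ContDiffAt ℂ ω (fun s => (c s).y) t) :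
    ContDiffAt ℂ ω (fun s => F (c s)) t := by
  rcases hF with hF | hF
  · simpa only [hF] using hx
  · simpa only [hF] using hy

/-- A function which agrees near a point with one of the two coordinates, transported through the
gluing. -/
theorem contDiffAt_glued {p p' : ℂ[X]} {F : AffineCurve p' → ℂ}
    (hF : (∀ r, F r = r.x) ∨ (∀ r, F r = r.y)) {c : ℂ → AffineCurve p} {t : ℂ}
    (hx : ContDiffAt ℂ ω (fun s => (c s).x) t) (hy : ContDiffAt ℂ ω (fun s => (c s).y) t)
    {G : ℂ → ℂ} (hG : ∀ᶠ s in 𝓝 t, ∃ r : AffineCurve p', AffineCurve.Glued g r (c s) ∧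
      G s = F r) :
    ContDiffAt ℂ ω G t := by
  have h0 : (c t).x ≠ 0 := by
    obtain ⟨r, hr, -⟩ := hG.self_of_nhds
    exact hr.ne_zero
  have hi : ContDiffAt ℂ ω (fun s => (c s).x⁻¹) t := hx.inv h0
  rcases hF with hF | hF
  · refine hi.congr_of_eventuallyEq ?_
    filter_upwards [hG] with s hs
    obtain ⟨r, hr, h⟩ := hs
    rw [h, hF, hr.x_eq]
  · refine (hy.mul (hi.pow (g + 1))).congr_of_eventuallyEq ?_
    filter_upwards [hG] with s hs
    obtain ⟨r, hr, h⟩ := hs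
    rw [h, hF, hr.y_eq]

/-- The compact hyperelliptic curve is a Riemann surface. -/
instance : IsManifold 𝓘(ℂ) ω D.Curve := by
  refine isManifold_of_contDiffOn _ _ _ fun e e' he he' => ?_
  simp only [modelWithCornersSelf_coe, modelWithCornersSelf_coe_symm, Function.id_comp,
    Function.comp_id, Set.preimage_id, Set.range_id, Set.inter_univ]
  intro t ht
  refine ContDiffAt.contDiffWithinAt ?_
  have hev := (e.symm.trans e').open_source.mem_nhds ht
  have htt : t ∈ e.target := ht.1
  rcases he with ⟨q, rfl⟩ | ⟨q, rfl⟩ <;> rcases he' with ⟨r, rfl⟩ | ⟨r, rfl⟩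
  · rw [affineChart_target] at htt
    obtain ⟨hx, hy⟩ := AffineCurve.contDiffAt_chart_symm _ q htt
    refine (contDiffAt_coord (AffineCurve.chart_apply D.nonsingular_f r)
      hx hy).congr_of_eventuallyEq (Filter.Eventually.of_forall fun s => ?_)
    simp only [OpenPartialHomeomorph.trans_apply, affineChart_symm_apply, affineChart_apply]
  · rw [affineChart_target] at htt
    obtain ⟨hx, hy⟩ := AffineCurve.contDiffAt_chart_symm _ q htt
    refine contDiffAt_glued (g := g) (AffineCurve.chart_apply D.nonsingular_fInf r) hx hy ?_
    filter_upwards [hev] with s hs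
    have hs2 := hs.2
    replace hs2 : (affineChart q).symm s ∈ (infinityChart r).source := hs2
    rw [infinityChart_source, affineChart_symm_apply] at hs2
    obtain ⟨r', -, hr'⟩ := hs2
    refine ⟨r', (ofAffine_eq_ofInfinity.1 hr'.symm).symm, ?_⟩
    simp only [OpenPartialHomeomorph.trans_apply, affineChart_symm_apply]
    rw [← hr', infinityChart_apply]
  · rw [infinityChart_target] at htt
    obtain ⟨hx, hy⟩ := AffineCurve.contDiffAt_chart_symm _ q htt
    refine contDiffAt_glued (g := g) (AffineCurve.chart_apply D.nonsingular_f r) hx hy ?_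
    filter_upwards [hev] with s hs
    have hs2 := hs.2
    replace hs2 : (infinityChart q).symm s ∈ (affineChart r).source := hs2
    rw [affineChart_source, infinityChart_symm_apply] at hs2
    obtain ⟨r', -, hr'⟩ := hs2
    refine ⟨r', ofAffine_eq_ofInfinity.1 hr', ?_⟩
    simp only [OpenPartialHomeomorph.trans_apply, infinityChart_symm_apply]
    rw [← hr', affineChart_apply]
  · rw [infinityChart_target] at htt
    obtain ⟨hx, hy⟩ := AffineCurve.contDiffAt_chart_symm _ q htt
    refine (contDiffAt_coord (AffineCurve.chart_apply D.nonsingular_fInf r)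
      hx hy).congr_of_eventuallyEq (Filter.Eventually.of_forall fun s => ?_)
    simp only [OpenPartialHomeomorph.trans_apply, infinityChart_symm_apply, infinityChart_apply]

/-- The meromorphic function `x`; at the points at infinity it takes the junk value `0`. -/
def xCoord (P : D.Curve) : ℂ :=
  Quotient.lift (s := D.setoid)
    (fun s : AffineCurve D.f ⊕ AffineCurve D.fInf => Sum.elim (fun q => q.x) (fun r => r.x⁻¹) s)
    (by
      rintro (a | a) (b | b) (h : D.Rel _ _) <;> simp only [Rel] at h
      · simp [h]
      · simpa using h.x_eq
      · simpa using h.x_eq.symm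
      · simp [h]) P

/-- The differential `dx`, as a linear form on each tangent space. -/
def dx (P : D.Curve) : TangentSpace 𝓘(ℂ) P →L[ℂ] ℂ :=
  mfderiv 𝓘(ℂ) 𝓘(ℂ) (xCoord : D.Curve → ℂ) P

/-- The set of Weierstrass points, i.e. the branch points of the double cover `(x, y) ↦ x`: the
points with `y = 0`, respectively `w = 0`. -/
def weierstrassPoints (D : HyperellipticDatum g) : Set D.Curve :=
  {P | (∃ q : AffineCurve D.f, q.y = 0 ∧ ofAffine q = P) ∨
    (∃ r : AffineCurve D.fInf, r.y = 0 ∧ ofInfinity r = P)}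

end Curve

end HyperellipticDatum

/-! ### Conformal metrics on Riemann surfaces -/

/-- The space `H⁰(M, Ω)` of holomorphic one-forms on a Riemann surface `M`. -/
abbrev HolomorphicOneForm (M : Type*) [TopologicalSpace M] [ChartedSpace ℂ M]
    [IsManifold 𝓘(ℂ) ω M] : Type _ :=
  ContMDiffSection 𝓘(ℂ) (ℂ →L[ℂ] ℂ) ω
    (fun P : M => TangentSpace 𝓘(ℂ) P →L[ℂ] Bundle.Trivial M ℂ P)

/-- The hermitian form `∑ᵢ ηᵢ ⊗ η̄ᵢ` on each tangent space. For a basis `η` of the holomorphic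
one-forms it is the canonical metric: the differential of the Abel-Jacobi map
`P ↦ (∫^P η₁, …, ∫^P η_g)` is `v ↦ (η₁ v, …, η_g v)`, so this is the pull-back of the standard
flat metric `∑ᵢ dzᵢ ⊗ dz̄ᵢ`. -/
def canonicalMetric {M : Type*} [TopologicalSpace M] [ChartedSpace ℂ M] [IsManifold 𝓘(ℂ) ω M]
    {ι : Type*} [Fintype ι] (η : ι → HolomorphicOneForm M) (P : M)
    (v w : TangentSpace 𝓘(ℂ) P) : ℂ :=
  ∑ i, (η i P v : ℂ) * (starRingEnd ℂ) (η i P w : ℂ)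

/-- The conformal factor `ρ` of a hermitian metric `h` in the chart `e` with coordinate `z`:
`h = ρ dz ⊗ dz̄`, i.e. `ρ = h(∂/∂z, ∂/∂z)`. -/
def conformalFactor {M : Type*} [TopologicalSpace M] [ChartedSpace ℂ M]
    (h : (P : M) → TangentSpace 𝓘(ℂ) P → TangentSpace 𝓘(ℂ) P → ℂ)
    (e : OpenPartialHomeomorph M ℂ) (z : ℂ) : ℝ :=
  (h (e.symm z) (mfderiv 𝓘(ℂ) 𝓘(ℂ) e.symm z (1 : ℂ))
    (mfderiv 𝓘(ℂ) 𝓘(ℂ) e.symm z (1 : ℂ))).re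

/-- The Laplace-Beltrami operator of the metric `h = ρ dz ⊗ dz̄`, namely
`(4 / ρ) ∂²/∂z∂z̄ = (1 / ρ) (∂²/∂s² + ∂²/∂t²)` for `z = s + it`. -/
def laplaceBeltrami {M : Type*} [TopologicalSpace M] [ChartedSpace ℂ M]
    (h : (P : M) → TangentSpace 𝓘(ℂ) P → TangentSpace 𝓘(ℂ) P → ℂ) (u : M → ℝ) (P : M) : ℝ :=
  (conformalFactor h (chartAt ℂ P) (chartAt ℂ P P))⁻¹ *
    Laplacian.laplacian (fun z : ℂ => u ((chartAt ℂ P).symm z)) (chartAt ℂ P P)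

/-- The Gaussian curvature `-(2 / ρ) ∂² log ρ / ∂z∂z̄` of the metric `h = ρ dz ⊗ dz̄`. -/
def gaussianCurvature {M : Type*} [TopologicalSpace M] [ChartedSpace ℂ M]
    (h : (P : M) → TangentSpace 𝓘(ℂ) P → TangentSpace 𝓘(ℂ) P → ℂ) (P : M) : ℝ :=
  -(1 / 2) * ((conformalFactor h (chartAt ℂ P) (chartAt ℂ P P))⁻¹ *
    Laplacian.laplacian (fun z : ℂ => Real.log (conformalFactor h (chartAt ℂ P) z))
      (chartAt ℂ P P))

/-- The mean field equation `Δu + r e^u = 4π ∑_{P ∈ Z} δ_P` in the sense of distributions on a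
Riemann surface with metric `h = ρ dz ⊗ dz̄`: the equation is tested against the smooth functions
`φ` with compact support in a chart. The volume form of `h` is `ρ` times Lebesgue measure, and
`Δφ` times the volume form is the Euclidean Laplacian of `φ` times Lebesgue measure. -/
def SatisfiesMeanFieldEquation {M : Type*} [TopologicalSpace M] [ChartedSpace ℂ M]
    (h : (P : M) → TangentSpace 𝓘(ℂ) P → TangentSpace 𝓘(ℂ) P → ℂ) (r : ℝ) (Z : Set M)
    (u : M → ℝ) : Prop :=
  ∀ e ∈ atlas ℂ M, ∀ φ : ℂ → ℝ, ContDiff ℝ ∞ φ → HasCompactSupport φ → tsupport φ ⊆ e.target →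
    MeasureTheory.IntegrableOn (fun z => u (e.symm z) * Laplacian.laplacian φ z) e.target ∧
    MeasureTheory.IntegrableOn
      (fun z => Real.exp (u (e.symm z)) * φ z * conformalFactor h e z) e.target ∧
    (∫ z in e.target, u (e.symm z) * Laplacian.laplacian φ z) +
        r * (∫ z in e.target, Real.exp (u (e.symm z)) * φ z * conformalFactor h e z) =
      4 * Real.pi * ∑ᶠ P ∈ Z ∩ e.source, φ (e P)

/-- The function `Φ = Δ log(-K) + 6 (-K)` of a metric with Gaussian curvature `K`. -/
def meanFieldDefect {M : Type*} [TopologicalSpace M] [ChartedSpace ℂ M]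
    (h : (P : M) → TangentSpace 𝓘(ℂ) P → TangentSpace 𝓘(ℂ) P → ℂ) (P : M) : ℝ :=
  laplaceBeltrami h (fun Q => Real.log (-gaussianCurvature h Q)) P + 6 * (-gaussianCurvature h P)

/-- The leading principal `k × k` submatrix of `C`. -/
def leadingSubmatrix {g : ℕ} (C : Matrix (Fin g) (Fin g) ℂ) (k : ℕ) (hk : k ≤ g) :
    Matrix (Fin k) (Fin k) ℂ :=
  C.submatrix (Fin.castLE hk) (Fin.castLE hk)

end

/-!
Away from the Weierstrass points the forms of the basis are `ηᵢ = pᵢ(x) dx / y`, with polynomials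
`pᵢ = ∑ⱼ aⱼᵢ x ^ j` of degree less than `g`, so in the coordinate `x` the canonical metric has the
conformal factor `ρ = |p|² / |f|` with `|p|² = ∑ᵢ |pᵢ|²`. Write `W₁ = |p|²`, `W₂ = |p ∧ p'|²` and
`W₃ = |p ∧ p' ∧ p''|²` for the Gram determinants (`gramDet`) of the derivatives of the polynomial
curve `p`. Since `log |f|` is harmonic, everything follows from the two Plücker formulas
(`laplacian_log_gramDet_one`, `laplacian_log_gramDet_two`)

  `Δ log W₁ = 4 W₂ / W₁²`,  `Δ log W₂ = 4 W₁ W₃ / W₂²`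

for the Euclidean Laplacian. The first one gives `K = -2 |f| W₂ / W₁³` (`gaussianCurvature_eq`).
In `Δ log (-K) + 6 (-K)` the terms that come from `log W₁` cancel against `6 (-K)`, and the second
formula leaves `Φ = 4 |f| W₃ / W₂²` (`meanFieldDefect_eq`). The matrix `A` is invertible and
`1, x, x²` all occur among the monomials because `g > 2`, so `p`, `p'`, `p''` are linearly
independent at every point and the `Wₙ` are positive (`gramDet_matrixCurve_pos`); hence `K < 0` and
`Φ > 0`. At `x = 0` the derivatives of `p` are the rows of `A` up to factorials, which gives
the value of `Φ` in terms of the minors of `A A*`.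

The matrix `A` exists without the Riemann-Roch theorem: the forms `x ^ j dx / y`, `j < g`, extend
to holomorphic one-forms on the compact curve (`monomialSection`) and are independent, and the
given basis says that the space of holomorphic one-forms has dimension `g`. At infinity the
same description holds in the coordinate `z = 1 / x`, with the rows of `A` reversed
(`reverseMatrix`).

The mean field equation fails because, tested against a bump function `φ` supported where
`y ≠ 0`, Green's identity (`integral_mul_laplacian`) turns it into `∫ 4 W₁ W₃ / W₂² φ = 0`, whereas
the integrand is nonnegative and positive at the centre of `φ`.
-/

noncomputable section

/-! ### Wirtinger derivatives -/

/-- The real-linear map `v ↦ a v + b v̄` of the complex plane. -/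
def wirtingerCLM (a b : ℂ) : ℂ →L[ℝ] ℂ :=
  a • ContinuousLinearMap.id ℝ ℂ + b • (Complex.conjCLE : ℂ →L[ℝ] ℂ)

theorem wirtingerCLM_apply (a b v : ℂ) :
    wirtingerCLM a b v = a * v + b * (starRingEnd ℂ) v := by
  simp [wirtingerCLM]

/-- The function `F` is real-differentiable at `z` with Wirtinger derivatives `∂F/∂z = a` and
`∂F/∂z̄ = b`. -/
def HasWirtinger (F : ℂ → ℂ) (a b z : ℂ) : Prop := HasFDerivAt F (wirtingerCLM a b) z

namespace HasWirtinger

variable {F H : ℂ → ℂ} {a b c d z : ℂ}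

theorem congr_deriv (h : HasWirtinger F a b z) (hc : a = c) (hd : b = d) :
    HasWirtinger F c d z := hc ▸ hd ▸ h

theorem sub (hF : HasWirtinger F a b z) (hH : HasWirtinger H c d z) :
    HasWirtinger (fun w => F w - H w) (a - c) (b - d) z := by
  refine (HasFDerivAt.sub hF hH).congr_fderiv ?_
  ext1 v
  simp only [sub_apply, wirtingerCLM_apply]
  ring

theorem mul (hF : HasWirtinger F a b z) (hH : HasWirtinger H c d z) :
    HasWirtinger (fun w => F w * H w) (a * H z + F z * c) (b * H z + F z * d) z := by
  refine (HasFDerivAt.mul hF hH).congr_fderiv ?_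
  ext1 v
  simp only [add_apply, smul_apply, wirtingerCLM_apply,
    smul_eq_mul]
  ring

theorem sum {ι : Type*} {s : Finset ι} {F : ι → ℂ → ℂ} {a b : ι → ℂ}
    (h : ∀ i ∈ s, HasWirtinger (F i) (a i) (b i) z) :
    HasWirtinger (fun w => ∑ i ∈ s, F i w) (∑ i ∈ s, a i) (∑ i ∈ s, b i) z := by
  refine (HasFDerivAt.fun_sum h).congr_fderiv ?_
  ext1 v
  simp only [sum_apply, wirtingerCLM_apply, Finset.sum_mul,
    Finset.sum_add_distrib]

theorem of_hasDerivAt (h : HasDerivAt F a z) : HasWirtinger F a 0 z := by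
  refine (h.hasFDerivAt.restrictScalars ℝ).congr_fderiv ?_
  ext1 v
  simp [wirtingerCLM_apply, mul_comm]

theorem conj (h : HasWirtinger F a b z) :
    HasWirtinger (fun w => (starRingEnd ℂ) (F w)) ((starRingEnd ℂ) b) ((starRingEnd ℂ) a) z := by
  refine ((Complex.conjCLE : ℂ →L[ℝ] ℂ).hasFDerivAt.comp z h).congr_fderiv ?_
  ext1 v
  simp [wirtingerCLM_apply, add_comm]

theorem comp_hasDerivAt {K : ℂ → ℂ} {k : ℂ} (hK : HasDerivAt K k (F z))
    (hF : HasWirtinger F a b z) : HasWirtinger (fun w => K (F w)) (k * a) (k * b) z := by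
  refine ((hK.hasFDerivAt.restrictScalars ℝ).comp z hF).congr_fderiv ?_
  ext1 v
  simp [wirtingerCLM_apply]
  ring

/-- The Laplacian is `4 ∂²/∂z∂z̄`; the mixed derivative is entered in both orders, so that no
symmetry of second derivatives is needed. -/
theorem laplacian_eq {a b : ℂ → ℂ} {a₁ a₂ b₁ b₂ : ℂ}
    (hF : ∀ᶠ w in 𝓝 z, HasWirtinger F (a w) (b w) w) (ha : HasWirtinger a a₁ a₂ z)
    (hb : HasWirtinger b b₁ b₂ z) : Laplacian.laplacian F z = 2 * (a₂ + b₁) := by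
  have h1 : fderiv ℝ F =ᶠ[𝓝 z] fun w => wirtingerCLM (a w) (b w) :=
    hF.mono fun w hw => HasFDerivAt.fderiv hw
  have h2 := (HasFDerivAt.smul_const ha (ContinuousLinearMap.id ℝ ℂ)).add
    (HasFDerivAt.smul_const hb (Complex.conjCLE : ℂ →L[ℝ] ℂ))
  have h3 := (h2.congr_of_eventuallyEq h1).fderiv
  rw [InnerProductSpace.laplacian_eq_iteratedFDeriv_complexPlane]
  simp only [iteratedFDeriv_two_apply, h3]
  simp [wirtingerCLM_apply]
  ring_nf
  simp
  ring

theorem log {F : ℂ → ℝ} (hF : HasWirtinger (fun w => (F w : ℂ)) a b z)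
    (h0 : ∀ᶠ w in 𝓝 z, 0 < F w) :
    HasWirtinger (fun w => (Real.log (F w) : ℂ)) (a / F z) (b / F z) z := by
  have h := comp_hasDerivAt (F := fun w => (F w : ℂ)) (Complex.hasDerivAt_log
    (Complex.ofReal_mem_slitPlane.2 h0.self_of_nhds)) hF
  rw [inv_mul_eq_div, inv_mul_eq_div] at h
  refine HasFDerivAt.congr_of_eventuallyEq h ?_
  filter_upwards [h0] with w hw
  exact Complex.ofReal_log hw.le

theorem div (hF : HasWirtinger F a b z) (hH : HasWirtinger H c d z) (h0 : H z ≠ 0) :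
    HasWirtinger (fun w => F w / H w) ((a * H z - F z * c) / H z ^ 2)
      ((b * H z - F z * d) / H z ^ 2) z := by
  have h := hF.mul (comp_hasDerivAt (hasDerivAt_inv h0) hH)
  simp only [← div_eq_mul_inv] at h
  refine h.congr_deriv ?_ ?_ <;> field_simp <;> ring

end HasWirtinger

/-- Passage between the Laplacians of a real function and of its complex-valued version, to which
the Wirtinger calculus applies. -/
theorem laplacian_ofReal {F : ℂ → ℝ} {z : ℂ} (h : ContDiffAt ℝ 2 F z) :
    Laplacian.laplacian (fun w => (F w : ℂ)) z = ((Laplacian.laplacian F z : ℝ) : ℂ) :=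
  h.laplacian_CLM_comp_left (l := Complex.ofRealCLM)

/-- `Δ log F = 4 (F ∂∂̄F - ∂F ∂̄F) / F²` for a positive function `F`. -/
theorem laplacian_log_eq {F : ℂ → ℝ} {z c : ℂ} {a b : ℂ → ℂ} {a₁ b₂ : ℂ}
    (hc : ContDiffAt ℝ 2 F z) (h0 : ∀ᶠ w in 𝓝 z, 0 < F w)
    (hF : ∀ᶠ w in 𝓝 z, HasWirtinger (fun w => (F w : ℂ)) (a w) (b w) w)
    (ha : HasWirtinger a a₁ c z) (hb : HasWirtinger b c b₂ z) :
    ((Laplacian.laplacian (fun w => Real.log (F w)) z : ℝ) : ℂ) =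
      4 * (F z * c - a z * b z) / (F z : ℂ) ^ 2 := by
  have h0z : (F z : ℂ) ≠ 0 := by exact_mod_cast h0.self_of_nhds.ne'
  rw [← laplacian_ofReal (hc.log h0.self_of_nhds.ne'),
    HasWirtinger.laplacian_eq (F := fun w => (Real.log (F w) : ℂ)) (a := fun w => a w / F w)
      (b := fun w => b w / F w) ?_ (ha.div hF.self_of_nhds h0z) (hb.div hF.self_of_nhds h0z)]
  · field_simp
    ring
  · filter_upwards [hF, h0.eventually_nhds] with w hw h0w
    exact hw.log h0w

/-! ### Gram determinants of the derivatives of a polynomial curve -/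

section Gram

variable {ι : Type*} (p : ι → ℂ[X])

/-- The `k`-th derivative at `z` of the polynomial curve `(pᵢ)ᵢ`. -/
def curveDeriv (k : ℕ) (z : ℂ) (i : ι) : ℂ := ((⇑Polynomial.derivative)^[k] (p i)).eval z

theorem hasDerivAt_curveDeriv (k : ℕ) (z : ℂ) (i : ι) :
    HasDerivAt (fun w => curveDeriv p k w i) (curveDeriv p (k + 1) z i) z := by
  simp only [curveDeriv, Function.iterate_succ_apply']
  exact Polynomial.hasDerivAt _ _

variable [Fintype ι]

/-- The hermitian product of the `k`-th and the `l`-th derivative of the polynomial curve. -/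
def derivInner (k l : ℕ) (z : ℂ) : ℂ :=
  ∑ i, curveDeriv p k z i * (starRingEnd ℂ) (curveDeriv p l z i)

/-- The Gram matrix of the derivatives of order less than `n` of the polynomial curve. -/
def derivGram (n : ℕ) (z : ℂ) : Matrix (Fin n) (Fin n) ℂ :=
  Matrix.of fun k l => derivInner p k l z

/-- The Gram determinant `|p ∧ p' ∧ ⋯ ∧ p⁽ⁿ⁻¹⁾|²` of a polynomial curve, a real number. -/
def gramDet (n : ℕ) (z : ℂ) : ℝ := (derivGram p n z).det.re

theorem hasWirtinger_derivInner (k l : ℕ) (z : ℂ) :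
    HasWirtinger (derivInner p k l) (derivInner p (k + 1) l z) (derivInner p k (l + 1) z) z := by
  refine (HasWirtinger.sum fun i _ => (HasWirtinger.of_hasDerivAt
    (hasDerivAt_curveDeriv p k z i)).mul (HasWirtinger.of_hasDerivAt
    (hasDerivAt_curveDeriv p l z i)).conj).congr_deriv ?_ ?_ <;> simp [derivInner]

theorem contDiff_derivInner (k l : ℕ) : ContDiff ℝ ∞ (derivInner p k l) := by
  have h : ∀ k i, ContDiff ℝ ∞ fun z => curveDeriv p k z i := fun k i =>
    ((polyContDiff _).restrict_scalars ℝ).of_le (by simp)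
  exact ContDiff.sum fun i _ => (h k i).mul (Complex.conjCLE.contDiff.comp (h l i))

theorem contDiff_gramDet (n : ℕ) : ContDiff ℝ ∞ (gramDet p n) := by
  refine Complex.reCLM.contDiff.comp (f := fun z => (derivGram p n z).det) ?_
  simp only [Matrix.det_apply]
  exact ContDiff.sum fun σ _ => (contDiff_prod fun i _ =>
    contDiff_derivInner p _ _).const_smul (Equiv.Perm.sign σ)

/-- The Gram matrix is `B B*`, which makes it hermitian, and positive definite if the rows of `B`
are independent. -/
theorem derivGram_eq_mul (n : ℕ) (z : ℂ) : derivGram p n z =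
    (Matrix.of fun (k : Fin n) i => curveDeriv p k z i) *
      (Matrix.of fun (k : Fin n) i => curveDeriv p k z i).conjTranspose := by
  ext k l
  simp [derivGram, derivInner, Matrix.mul_apply]

theorem isHermitian_derivGram (n : ℕ) (z : ℂ) : (derivGram p n z).IsHermitian := by
  rw [derivGram_eq_mul]
  exact Matrix.isHermitian_mul_conjTranspose_self _

theorem ofReal_gramDet (n : ℕ) (z : ℂ) : (gramDet p n z : ℂ) = (derivGram p n z).det := by
  refine Complex.conj_eq_iff_re.1 ?_
  have h := (derivGram p n z).det_conjTranspose
  rw [(isHermitian_derivGram p n z).eq] at h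
  exact h.symm

open scoped ComplexOrder in
theorem gramDet_pos {n : ℕ} {z : ℂ}
    (h : LinearIndependent ℂ fun k : Fin n => curveDeriv p k z) : 0 < gramDet p n z := by
  have hP : (derivGram p n z).PosDef := by
    rw [derivGram_eq_mul]
    refine Matrix.PosDef.mul_conjTranspose_self _ ?_
    rw [Matrix.vecMul_injective_iff]
    exact h
  have := hP.det_pos
  rw [← ofReal_gramDet] at this
  exact_mod_cast this

theorem ofReal_gramDet_one (z : ℂ) : (gramDet p 1 z : ℂ) = derivInner p 0 0 z := by
  rw [ofReal_gramDet, Matrix.det_fin_one]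
  rfl

theorem ofReal_gramDet_two (z : ℂ) : (gramDet p 2 z : ℂ) =
    derivInner p 0 0 z * derivInner p 1 1 z - derivInner p 0 1 z * derivInner p 1 0 z := by
  rw [ofReal_gramDet, Matrix.det_fin_two]
  rfl

/-- The first Plücker formula `∂∂̄ log |p|² = |p ∧ p'|² / |p|⁴`. -/
theorem laplacian_log_gramDet_one {z : ℂ} (h : ∀ w, 0 < gramDet p 1 w) :
    Laplacian.laplacian (fun w => Real.log (gramDet p 1 w)) z =
      4 * gramDet p 2 z / gramDet p 1 z ^ 2 := by
  have key := laplacian_log_eq (F := gramDet p 1) (z := z)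
    (contDiff_infty.1 (contDiff_gramDet p 1) 2).contDiffAt
    (Filter.Eventually.of_forall h)
    (Filter.Eventually.of_forall fun w => by
      simp only [ofReal_gramDet_one]
      exact hasWirtinger_derivInner p 0 0 w)
    (hasWirtinger_derivInner p 1 0 z) (hasWirtinger_derivInner p 0 1 z)
  rw [← Complex.ofReal_inj, key]
  push_cast
  rw [ofReal_gramDet_two, ofReal_gramDet_one]
  ring

/-- The second Plücker formula `∂∂̄ log |p ∧ p'|² = |p|² |p ∧ p' ∧ p''|² / |p ∧ p'|⁴`. -/
theorem laplacian_log_gramDet_two {z : ℂ} (h : ∀ w, 0 < gramDet p 2 w) :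
    Laplacian.laplacian (fun w => Real.log (gramDet p 2 w)) z =
      4 * (gramDet p 1 z * gramDet p 3 z) / gramDet p 2 z ^ 2 := by
  have key := laplacian_log_eq (F := gramDet p 2) (z := z)
    (a := fun w => derivInner p 0 0 w * derivInner p 2 1 w -
      derivInner p 0 1 w * derivInner p 2 0 w)
    (b := fun w => derivInner p 0 0 w * derivInner p 1 2 w -
      derivInner p 0 2 w * derivInner p 1 0 w)
    (c := derivInner p 0 0 z * derivInner p 2 2 z - derivInner p 0 2 z * derivInner p 2 0 z)
    (contDiff_infty.1 (contDiff_gramDet p 2) 2).contDiffAt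
    (Filter.Eventually.of_forall h)
    (Filter.Eventually.of_forall fun w => by
      simp only [ofReal_gramDet_two]
      refine (((hasWirtinger_derivInner p 0 0 w).mul (hasWirtinger_derivInner p 1 1 w)).sub
        ((hasWirtinger_derivInner p 0 1 w).mul (hasWirtinger_derivInner p 1 0 w))).congr_deriv
        ?_ ?_ <;> ring)
    ((((hasWirtinger_derivInner p 0 0 z).mul (hasWirtinger_derivInner p 2 1 z)).sub
        ((hasWirtinger_derivInner p 0 1 z).mul (hasWirtinger_derivInner p 2 0 z))).congr_deriv
        rfl (by ring))
    ((((hasWirtinger_derivInner p 0 0 z).mul (hasWirtinger_derivInner p 1 2 z)).sub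
        ((hasWirtinger_derivInner p 0 2 z).mul (hasWirtinger_derivInner p 1 0 z))).congr_deriv
        (by ring) rfl)
  rw [← Complex.ofReal_inj, key]
  push_cast
  congr 1
  rw [ofReal_gramDet_two, ofReal_gramDet_one, ofReal_gramDet p 3, Matrix.det_fin_three]
  simp only [derivGram, Matrix.of_apply, Fin.val_zero, Fin.val_one, Fin.val_two]
  ring

end Gram

/-! ### Metrics with conformal factor `|p|² / |q|` -/

section Metric

variable {ι : Type*} [Fintype ι] (p : ι → ℂ[X]) (q : ℂ[X])

/-- The function `log (2 |q| |p ∧ p'|² / |p|⁶)`: it is `log (-K)` for the metric with conformal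
factor `|p|² / |q|`. -/
def logNegCurvature (z : ℂ) : ℝ :=
  Real.log (2 * ‖q.eval z‖ * gramDet p 2 z / gramDet p 1 z ^ 3)

variable {p q}

theorem contDiffAt_log_norm_eval {z : ℂ} (hq : q.eval z ≠ 0) :
    ContDiffAt ℝ ∞ (fun w => Real.log ‖q.eval w‖) z := by
  have h : ContDiffAt ℝ ∞ (fun w => q.eval w) z :=
    (((polyContDiff q).restrict_scalars ℝ).of_le (by simp)).contDiffAt
  exact (h.norm ℝ hq).log (norm_ne_zero_iff.2 hq)

theorem laplacian_log_norm_eval {z : ℂ} (hq : q.eval z ≠ 0) :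
    Laplacian.laplacian (fun w => Real.log ‖q.eval w‖) z = 0 := by
  have h : AnalyticAt ℂ (fun w => q.eval w) z := (polyContDiff q).contDiffAt.analyticAt
  exact (h.harmonicAt_log_norm hq).2.self_of_nhds

theorem eventually_eval_ne_zero {z : ℂ} (hq : q.eval z ≠ 0) : ∀ᶠ w in 𝓝 z, q.eval w ≠ 0 :=
  q.continuous.continuousAt.eventually_ne hq

theorem contDiff_log_gramDet {n : ℕ} (h : ∀ z, 0 < gramDet p n z) :
    ContDiff ℝ ∞ fun z => Real.log (gramDet p n z) :=
  (contDiff_gramDet p n).log fun z => (h z).ne'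

theorem logNegCurvature_eq (h1 : ∀ z, 0 < gramDet p 1 z) (h2 : ∀ z, 0 < gramDet p 2 z) {z : ℂ}
    (hq : q.eval z ≠ 0) : logNegCurvature p q z = Real.log 2 + Real.log ‖q.eval z‖ +
      Real.log (gramDet p 2 z) - 3 * Real.log (gramDet p 1 z) := by
  have := norm_ne_zero_iff.2 hq
  have := (h1 z).ne'
  have := (h2 z).ne'
  rw [logNegCurvature, Real.log_div (by positivity) (by positivity),
    Real.log_mul (by positivity) (by positivity), Real.log_mul (by positivity) (by positivity),
    Real.log_pow]
  norm_num

theorem logNegCurvature_eventuallyEq (h1 : ∀ z, 0 < gramDet p 1 z) (h2 : ∀ z, 0 < gramDet p 2 z)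
    {z : ℂ} (hq : q.eval z ≠ 0) : logNegCurvature p q =ᶠ[𝓝 z]
      ((((fun _ => Real.log 2) + fun w => Real.log ‖q.eval w‖) +
        fun w => Real.log (gramDet p 2 w)) - (3 : ℝ) • fun w => Real.log (gramDet p 1 w)) :=
  (eventually_eval_ne_zero hq).mono fun _ hw => logNegCurvature_eq h1 h2 hw

theorem contDiffAt_logNegCurvature (h1 : ∀ z, 0 < gramDet p 1 z) (h2 : ∀ z, 0 < gramDet p 2 z)
    {z : ℂ} (hq : q.eval z ≠ 0) : ContDiffAt ℝ ∞ (logNegCurvature p q) z :=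
  (((contDiffAt_const.add (contDiffAt_log_norm_eval hq)).add
    (contDiff_log_gramDet h2).contDiffAt).sub
    (contDiffAt_const.smul (contDiff_log_gramDet h1).contDiffAt)).congr_of_eventuallyEq
    (logNegCurvature_eventuallyEq h1 h2 hq)

theorem laplacian_logNegCurvature (h1 : ∀ z, 0 < gramDet p 1 z) (h2 : ∀ z, 0 < gramDet p 2 z)
    {z : ℂ} (hq : q.eval z ≠ 0) : Laplacian.laplacian (logNegCurvature p q) z =
      4 * (gramDet p 1 z * gramDet p 3 z) / gramDet p 2 z ^ 2 -
        3 * (4 * gramDet p 2 z / gramDet p 1 z ^ 2) := by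
  have c0 := contDiffAt_infty.1 (contDiffAt_log_norm_eval hq) 2
  have c1 := contDiffAt_infty.1 ((contDiff_log_gramDet h1).contDiffAt (x := z)) 2
  have c2 := contDiffAt_infty.1 ((contDiff_log_gramDet h2).contDiffAt (x := z)) 2
  have cc : ContDiffAt ℝ 2 (fun _ : ℂ => Real.log 2) z := contDiffAt_const
  have c01 : ContDiffAt ℝ 2 ((fun _ => Real.log 2) + fun w => Real.log ‖q.eval w‖) z := cc.add c0
  have c012 : ContDiffAt ℝ 2 (((fun _ => Real.log 2) + fun w => Real.log ‖q.eval w‖) +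
    fun w => Real.log (gramDet p 2 w)) z := c01.add c2
  have c3 : ContDiffAt ℝ 2 ((3 : ℝ) • fun w => Real.log (gramDet p 1 w)) z :=
    contDiffAt_const.smul c1
  rw [(InnerProductSpace.laplacian_congr_nhds
      (logNegCurvature_eventuallyEq h1 h2 hq)).self_of_nhds,
    c012.laplacian_sub c3, c01.laplacian_add c2, cc.laplacian_add c0,
    InnerProductSpace.laplacian_smul _ c1, laplacian_log_norm_eval hq,
    laplacian_log_gramDet_one p h1, laplacian_log_gramDet_two p h2]
  simp

variable {M : Type*} [TopologicalSpace M] [ChartedSpace ℂ M]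
  {h : (P : M) → TangentSpace 𝓘(ℂ) P → TangentSpace 𝓘(ℂ) P → ℂ} {P : M}

/-- The curvature of the metric with conformal factor `|p|² / |q|` is
`K = -2 |q| |p ∧ p'|² / |p|⁶`. -/
theorem gaussianCurvature_eq (h1 : ∀ z, 0 < gramDet p 1 z)
    (hq : q.eval (chartAt ℂ P P) ≠ 0)
    (hρ : ∀ᶠ z in 𝓝 (chartAt ℂ P P),
      conformalFactor h (chartAt ℂ P) z = gramDet p 1 z / ‖q.eval z‖) :
    gaussianCurvature h P = -(2 * ‖q.eval (chartAt ℂ P P)‖ * gramDet p 2 (chartAt ℂ P P) /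
      gramDet p 1 (chartAt ℂ P P) ^ 3) := by
  set z := chartAt ℂ P P
  have c0 := contDiffAt_infty.1 (contDiffAt_log_norm_eval hq) 2
  have c1 := contDiffAt_infty.1 ((contDiff_log_gramDet h1).contDiffAt (x := z)) 2
  have hlog : (fun w => Real.log (conformalFactor h (chartAt ℂ P) w)) =ᶠ[𝓝 z]
      (fun w => Real.log (gramDet p 1 w)) - fun w => Real.log ‖q.eval w‖ := by
    filter_upwards [hρ, eventually_eval_ne_zero hq] with w hw hw0
    rw [hw, Real.log_div (h1 w).ne' (norm_ne_zero_iff.2 hw0)]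
    rfl
  have := norm_ne_zero_iff.2 hq
  have := (h1 z).ne'
  rw [gaussianCurvature, (InnerProductSpace.laplacian_congr_nhds hlog).self_of_nhds,
    c1.laplacian_sub c0, laplacian_log_norm_eval hq, laplacian_log_gramDet_one p h1,
    hρ.self_of_nhds]
  field_simp
  ring

/-- The curvature terms of `Δ log (-K)` and `6 (-K)` cancel, and only the third Gram determinant
is left: `Φ = 4 |q| |p ∧ p' ∧ p''|² / |p ∧ p'|⁴`. -/
theorem meanFieldDefect_eq (h1 : ∀ z, 0 < gramDet p 1 z) (h2 : ∀ z, 0 < gramDet p 2 z)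
    (hq : q.eval (chartAt ℂ P P) ≠ 0)
    (hρ : ∀ᶠ z in 𝓝 (chartAt ℂ P P),
      conformalFactor h (chartAt ℂ P) z = gramDet p 1 z / ‖q.eval z‖)
    (hu : ∀ᶠ z in 𝓝 (chartAt ℂ P P),
      Real.log (-gaussianCurvature h ((chartAt ℂ P).symm z)) = logNegCurvature p q z) :
    meanFieldDefect h P = 4 * ‖q.eval (chartAt ℂ P P)‖ * gramDet p 3 (chartAt ℂ P P) /
      gramDet p 2 (chartAt ℂ P P) ^ 2 := by
  have := norm_ne_zero_iff.2 hq
  have := (h1 (chartAt ℂ P P)).ne'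
  have := (h2 (chartAt ℂ P P)).ne'
  rw [meanFieldDefect, laplaceBeltrami, (InnerProductSpace.laplacian_congr_nhds hu).self_of_nhds,
    laplacian_logNegCurvature h1 h2 hq, gaussianCurvature_eq h1 hq hρ, hρ.self_of_nhds]
  field_simp
  ring

end Metric

/-! ### The one-forms `a(x) dx / y` -/

section Forms

variable {M : Type*} [TopologicalSpace M] [ChartedSpace ℂ M]

/-- A field of linear forms on the tangent spaces of `M`. -/
abbrev FormField (M : Type*) [TopologicalSpace M] [ChartedSpace ℂ M] : Type _ :=
  (P : M) → TangentSpace 𝓘(ℂ) P →L[ℂ] Bundle.Trivial M ℂ P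

/-- The differential of a function, as a field of linear forms. -/
def differential (F : M → ℂ) : FormField M := fun P => mfderiv 𝓘(ℂ) 𝓘(ℂ) F P

variable [IsManifold 𝓘(ℂ) ω M]

/-- Holomorphy of a one-form at a point. -/
def HolomorphicFormAt (s : FormField M) (P : M) : Prop :=
  ContMDiffAt 𝓘(ℂ) (𝓘(ℂ).prod 𝓘(ℂ, ℂ →L[ℂ] ℂ)) ω
    (fun Q => Bundle.TotalSpace.mk' (ℂ →L[ℂ] ℂ)
      (E := fun P : M => TangentSpace 𝓘(ℂ) P →L[ℂ] Bundle.Trivial M ℂ P) Q (s Q)) P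

theorem holomorphicFormAt_differential {F : M → ℂ} {P : M}
    (hF : ContMDiffAt 𝓘(ℂ) 𝓘(ℂ) ω F P) : HolomorphicFormAt (differential F) P := by
  unfold HolomorphicFormAt
  rw [contMDiffAt_hom_bundle]
  refine ⟨contMDiffAt_id, ?_⟩
  have := hF.mfderiv_const (m := ω) (by simp)
  refine this.congr_of_eventuallyEq ?_
  refine Filter.Eventually.of_forall fun Q => ?_
  simp [inTangentCoordinates, ContinuousLinearMap.inCoordinates, differential]
  rfl

theorem HolomorphicFormAt.smul {F : M → ℂ} {s : FormField M} {P : M}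
    (hs : HolomorphicFormAt s P) (hF : ContMDiffAt 𝓘(ℂ) 𝓘(ℂ) ω F P) :
    HolomorphicFormAt (fun Q => F Q • s Q) P :=
  ContMDiffAt.smul_section hF hs

theorem HolomorphicFormAt.congr {s t : FormField M} {P : M}
    (hs : HolomorphicFormAt s P) (h : ∀ᶠ Q in 𝓝 P, t Q = s Q) : HolomorphicFormAt t P := by
  refine ContMDiffAt.congr_of_eventuallyEq hs ?_
  filter_upwards [h] with Q hQ
  rw [hQ]

omit [IsManifold 𝓘(ℂ) ω M] in
theorem differential_comp {k : ℂ → ℂ} {k' : ℂ} {F : M → ℂ} {P : M}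
    (hF : MDifferentiableAt 𝓘(ℂ) 𝓘(ℂ) F P) (hk : HasDerivAt k k' (F P)) :
    differential (fun Q => k (F Q)) P = k' • differential F P := by
  have h := (hk.hasFDerivAt.hasMFDerivAt.comp P hF.hasMFDerivAt).mfderiv
  refine ContinuousLinearMap.ext fun v => (DFunLike.congr_fun h v).trans ?_
  exact mul_comm (differential F P v : ℂ) k'

open Classical in
/-- The one-form `a(X) dX / Y` on a branched double cover `Y² = p(X)`, written as
`2 a(X) dY / p'(X)` at the points with `Y = 0`. -/
def sheetForm (p a : ℂ[X]) (X Y : M → ℂ) : FormField M := fun P =>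
  if Y P ≠ 0 then (a.eval (X P) / Y P) • differential X P
  else (2 * a.eval (X P) / p.derivative.eval (X P)) • differential Y P

omit [IsManifold 𝓘(ℂ) ω M] in
theorem contMDiffAt_eval (p : ℂ[X]) {X : M → ℂ} {P : M} (hX : ContMDiffAt 𝓘(ℂ) 𝓘(ℂ) ω X P) :
    ContMDiffAt 𝓘(ℂ) 𝓘(ℂ) ω (fun Q => p.eval (X Q)) P :=
  (polyContDiff p).contMDiff.contMDiffAt.comp P hX

omit [IsManifold 𝓘(ℂ) ω M] in
/-- The relation `2 Y dY = p'(X) dX` on the curve `Y² = p(X)`. -/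
theorem differential_sheet {p : ℂ[X]} {X Y : M → ℂ} {P : M}
    (hX : ContMDiffAt 𝓘(ℂ) 𝓘(ℂ) ω X P) (hY : ContMDiffAt 𝓘(ℂ) 𝓘(ℂ) ω Y P)
    (hE : ∀ᶠ Q in 𝓝 P, Y Q ^ 2 = p.eval (X Q)) :
    (2 * Y P) • differential Y P = p.derivative.eval (X P) • differential X P := by
  have h1 := differential_comp (hY.mdifferentiableAt (by simp)) (hasDerivAt_pow 2 (Y P))
  have h2 := differential_comp (hX.mdifferentiableAt (by simp)) (p.hasDerivAt (X P))
  have h3 : differential (fun Q => Y Q ^ 2) P = differential (fun Q => p.eval (X Q)) P :=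
    ContinuousLinearMap.ext fun v => DFunLike.congr_fun (Filter.EventuallyEq.mfderiv_eq
      (f₁ := fun Q => Y Q ^ 2) (f := fun Q => p.eval (X Q)) hE) v
  rw [← h2, ← h3, h1]
  simp

/-- The form is holomorphic at the points with `Y = 0` too: there `p'(X) ≠ 0`, and
`a(X) dX / Y = 2 a(X) dY / p'(X)` nearby. -/
theorem holomorphicFormAt_sheetForm {p : ℂ[X]} (a : ℂ[X]) (hp : AffineCurve.Nonsingular p)
    {X Y : M → ℂ} {P : M}
    (hX : ∀ᶠ Q in 𝓝 P, ContMDiffAt 𝓘(ℂ) 𝓘(ℂ) ω X Q)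
    (hY : ∀ᶠ Q in 𝓝 P, ContMDiffAt 𝓘(ℂ) 𝓘(ℂ) ω Y Q)
    (hE : ∀ᶠ Q in 𝓝 P, Y Q ^ 2 = p.eval (X Q)) :
    HolomorphicFormAt (sheetForm p a X Y) P := by
  have hX0 := hX.self_of_nhds
  have hY0 := hY.self_of_nhds
  by_cases h0 : Y P = 0
  · have hd : p.derivative.eval (X P) ≠ 0 := hp _ (by rw [← hE.self_of_nhds, h0]; simp)
    have hdc := contMDiffAt_eval p.derivative hX0
    refine ((holomorphicFormAt_differential hY0).smul
      (((contMDiffAt_const (c := (2 : ℂ))).mul (contMDiffAt_eval a hX0)).div₀ hdc hd)).congr ?_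
    filter_upwards [hX, hY, hE.eventually_nhds, hdc.continuousAt.eventually_ne hd] with Q h1 h2 h3 h4
    unfold sheetForm
    split_ifs with h5
    · have h6 := differential_sheet h1 h2 h3
      have h7 : differential X Q = (p.derivative.eval (X Q))⁻¹ • (2 * Y Q) • differential Y Q := by
        rw [h6, smul_smul, inv_mul_cancel₀ h4, one_smul]
      rw [h7, smul_smul, smul_smul]
      congr 1
      simp only [Pi.div_apply, Pi.mul_apply]
      field_simp
    · rfl
  · refine ((holomorphicFormAt_differential hX0).smul
      ((contMDiffAt_eval a hX0).div₀ hY0 h0)).congr ?_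
    filter_upwards [hY0.continuousAt.eventually_ne h0] with Q hQ
    exact if_pos hQ

theorem contMDiffAt_of_chart {e : OpenPartialHomeomorph M ℂ} (he : e ∈ atlas ℂ M) {F : M → ℂ}
    {P : M} (hP : P ∈ e.source) (hF : ContDiffAt ℂ ω (fun z => F (e.symm z)) (e P)) :
    ContMDiffAt 𝓘(ℂ) 𝓘(ℂ) ω F P := by
  refine (hF.contMDiffAt.comp P (contMDiffAt_of_mem_maximalAtlas
    (IsManifold.subset_maximalAtlas he) hP)).congr_of_eventuallyEq ?_
  filter_upwards [e.open_source.mem_nhds hP] with Q hQ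
  simp [e.left_inv hQ]

/-- If the function `F` is the coordinate of the chart `e`, then `dF` takes the value `1` on the
coordinate vector field of `e`. -/
theorem differential_mfderiv_symm {e : OpenPartialHomeomorph M ℂ} (he : e ∈ atlas ℂ M)
    {F : M → ℂ} {z : ℂ} (hz : z ∈ e.target) (hF : ContMDiffAt 𝓘(ℂ) 𝓘(ℂ) ω F (e.symm z))
    (h : ∀ w ∈ e.target, F (e.symm w) = w) :
    differential F (e.symm z) (mfderiv 𝓘(ℂ) 𝓘(ℂ) e.symm z (1 : ℂ)) = (1 : ℂ) := by
  have h1 := (hF.mdifferentiableAt (by simp)).hasMFDerivAt.comp z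
    (mdifferentiableAt_atlas_symm he hz).hasMFDerivAt
  have h2 : HasMFDerivAt 𝓘(ℂ) 𝓘(ℂ) (F ∘ e.symm) z (ContinuousLinearMap.id ℂ ℂ) :=
    (hasMFDerivAt_id z).congr_of_eventuallyEq
      (Filter.mem_of_superset (e.open_target.mem_nhds hz) h)
  exact DFunLike.congr_fun (hasMFDerivAt_unique h1 h2) (1 : ℂ)

end Forms

/-! ### Coordinate functions and holomorphic one-forms on the hyperelliptic curve -/

namespace HyperellipticDatum.Curve

variable {g : ℕ} {D : HyperellipticDatum g}

/-- The function on the compact curve given by a pair of functions on the two affine curves that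
are compatible with the gluing. -/
def glueFun (F : AffineCurve D.f → ℂ) (G : AffineCurve D.fInf → ℂ)
    (h : ∀ q r, AffineCurve.Glued g q r → F q = G r) (P : D.Curve) : ℂ :=
  Quotient.lift (s := D.setoid) (Sum.elim F G) (by
    rintro (a | a) (b | b) (hab : D.Rel _ _) <;> simp only [Rel] at hab
    · rw [hab]
    · exact h _ _ hab
    · exact (h _ _ hab).symm
    · rw [hab]) P

/-- The meromorphic function `y`; at the points with `z = 0` it takes a junk value. -/
def yCoord : D.Curve → ℂ :=
  glueFun (fun q => q.y) (fun r => r.y * r.x⁻¹ ^ (g + 1)) fun _ _ h => h.y_eq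

/-- The meromorphic function `z = 1 / x`; at the points with `x = 0` it takes the junk value
`0`. -/
def zCoord : D.Curve → ℂ :=
  glueFun (fun q => q.x⁻¹) (fun r => r.x) fun _ _ h => h.symm.x_eq.symm

/-- The meromorphic function `w = y / x ^ (g + 1)`; at the points with `x = 0` it takes a junk
value. -/
def wCoord : D.Curve → ℂ :=
  glueFun (fun q => q.y * q.x⁻¹ ^ (g + 1)) (fun r => r.y) fun _ _ h => h.symm.y_eq.symm

theorem xCoord_ofAffine (q : AffineCurve D.f) : xCoord (ofAffine q) = q.x := rfl
theorem yCoord_ofAffine (q : AffineCurve D.f) : yCoord (ofAffine q) = q.y := rfl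
theorem zCoord_ofInfinity (r : AffineCurve D.fInf) : zCoord (ofInfinity r) = r.x := rfl
theorem wCoord_ofInfinity (r : AffineCurve D.fInf) : wCoord (ofInfinity r) = r.y := rfl

theorem xCoord_eq_inv (P : D.Curve) : xCoord P = (zCoord P)⁻¹ := by
  rcases exists_rep P with ⟨q, rfl⟩ | ⟨r, rfl⟩
  · exact (inv_inv q.x).symm
  · rfl

theorem affineChart_mem_atlas (q : AffineCurve D.f) : affineChart q ∈ atlas ℂ D.Curve :=
  Or.inl ⟨q, rfl⟩

theorem infinityChart_mem_atlas (r : AffineCurve D.fInf) :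
    infinityChart r ∈ atlas ℂ D.Curve :=
  Or.inr ⟨r, rfl⟩

theorem mem_affineChart_source (q : AffineCurve D.f) : ofAffine q ∈ (affineChart q).source := by
  rw [affineChart_source]
  exact ⟨q, AffineCurve.mem_chart_source _ _, rfl⟩

theorem mem_infinityChart_source (r : AffineCurve D.fInf) :
    ofInfinity r ∈ (infinityChart r).source := by
  rw [infinityChart_source]
  exact ⟨r, AffineCurve.mem_chart_source _ _, rfl⟩

theorem contMDiffAt_ofAffine {F : D.Curve → ℂ}
    (hF : (∀ q, F (ofAffine q) = q.x) ∨ (∀ q, F (ofAffine q) = q.y)) (q : AffineCurve D.f) :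
    ContMDiffAt 𝓘(ℂ) 𝓘(ℂ) ω F (ofAffine q) := by
  have hq := mem_affineChart_source q
  refine contMDiffAt_of_chart (affineChart_mem_atlas q) hq ?_
  have ht := (affineChart q).map_source hq
  rw [affineChart_target] at ht
  obtain ⟨hx, hy⟩ := AffineCurve.contDiffAt_chart_symm _ q ht
  simp only [affineChart_symm_apply]
  exact contDiffAt_coord hF hx hy

theorem contMDiffAt_ofInfinity {F : D.Curve → ℂ}
    (hF : (∀ r, F (ofInfinity r) = r.x) ∨ (∀ r, F (ofInfinity r) = r.y))
    (r : AffineCurve D.fInf) : ContMDiffAt 𝓘(ℂ) 𝓘(ℂ) ω F (ofInfinity r) := by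
  have hq := mem_infinityChart_source r
  refine contMDiffAt_of_chart (infinityChart_mem_atlas r) hq ?_
  have ht := (infinityChart r).map_source hq
  rw [infinityChart_target] at ht
  obtain ⟨hx, hy⟩ := AffineCurve.contDiffAt_chart_symm _ r ht
  simp only [infinityChart_symm_apply]
  exact contDiffAt_coord hF hx hy

theorem contMDiffAt_xCoord (q : AffineCurve D.f) :
    ContMDiffAt 𝓘(ℂ) 𝓘(ℂ) ω (xCoord : D.Curve → ℂ) (ofAffine q) :=
  contMDiffAt_ofAffine (Or.inl xCoord_ofAffine) q

theorem contMDiffAt_yCoord (q : AffineCurve D.f) :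
    ContMDiffAt 𝓘(ℂ) 𝓘(ℂ) ω (yCoord : D.Curve → ℂ) (ofAffine q) :=
  contMDiffAt_ofAffine (Or.inr yCoord_ofAffine) q

theorem contMDiffAt_zCoord (r : AffineCurve D.fInf) :
    ContMDiffAt 𝓘(ℂ) 𝓘(ℂ) ω (zCoord : D.Curve → ℂ) (ofInfinity r) :=
  contMDiffAt_ofInfinity (Or.inl zCoord_ofInfinity) r

theorem contMDiffAt_wCoord (r : AffineCurve D.fInf) :
    ContMDiffAt 𝓘(ℂ) 𝓘(ℂ) ω (wCoord : D.Curve → ℂ) (ofInfinity r) :=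
  contMDiffAt_ofInfinity (Or.inr wCoord_ofInfinity) r

theorem eventually_ofAffine {p : D.Curve → Prop} (h : ∀ q, p (ofAffine q)) (q : AffineCurve D.f) :
    ∀ᶠ P in 𝓝 (ofAffine q), p P :=
  Filter.mem_of_superset (isOpenEmbedding_ofAffine.isOpen_range.mem_nhds ⟨q, rfl⟩)
    (by rintro _ ⟨q', rfl⟩; exact h q')

theorem eventually_ofInfinity {p : D.Curve → Prop} (h : ∀ r, p (ofInfinity r))
    (r : AffineCurve D.fInf) : ∀ᶠ P in 𝓝 (ofInfinity r), p P :=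
  Filter.mem_of_superset (isOpenEmbedding_ofInfinity.isOpen_range.mem_nhds ⟨r, rfl⟩)
    (by rintro _ ⟨q', rfl⟩; exact h q')

open Classical in
/-- The one-form `x ^ j dx / y = -z ^ (g - 1 - j) dz / w` on the compact curve. -/
def monomialForm (j : Fin g) : FormField D.Curve := fun P =>
  if P ∈ Set.range (ofAffine : AffineCurve D.f → D.Curve) then
    sheetForm D.f (Polynomial.X ^ (j : ℕ)) xCoord yCoord P
  else sheetForm D.fInf (-Polynomial.X ^ (g - 1 - j : ℕ)) zCoord wCoord P

theorem monomialForm_ofAffine (j : Fin g) (q : AffineCurve D.f) :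
    monomialForm j (ofAffine q) =
      sheetForm D.f (Polynomial.X ^ (j : ℕ)) xCoord yCoord (ofAffine q) :=
  if_pos ⟨q, rfl⟩

/-- The identity `x ^ j dx / y = -z ^ (g - 1 - j) dz / w` on the overlap of the affine curves; it is
only needed where `w ≠ 0`, because the remaining points of the overlap stay away from `z = 0`. -/
theorem sheetForm_eq_of_glued (j : Fin g) {q : AffineCurve D.f} {r : AffineCurve D.fInf}
    (h : AffineCurve.Glued g q r) (hr : r.y ≠ 0) :
    sheetForm D.f (Polynomial.X ^ (j : ℕ)) xCoord yCoord (ofInfinity r) =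
      sheetForm D.fInf (-Polynomial.X ^ (g - 1 - j : ℕ)) zCoord wCoord (ofInfinity r) := by
  have hx := h.ne_zero
  have hyr : yCoord (ofInfinity r) = r.y * r.x⁻¹ ^ (g + 1) := rfl
  have hy : yCoord (ofInfinity r) ≠ 0 := by
    rw [hyr]
    exact mul_ne_zero hr (pow_ne_zero _ (inv_ne_zero hx))
  have hd : differential (xCoord : D.Curve → ℂ) (ofInfinity r) =
      (-(r.x ^ 2)⁻¹) • differential (zCoord : D.Curve → ℂ) (ofInfinity r) := by
    have h1 := differential_comp ((contMDiffAt_zCoord r).mdifferentiableAt (by simp))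
      (hasDerivAt_inv (x := zCoord (ofInfinity r)) hx)
    rw [← funext (xCoord_eq_inv (D := D))] at h1
    exact h1
  have hj : (g + 1 : ℕ) = (g - 1 - j) + 2 + j := by omega
  rw [sheetForm, sheetForm, if_pos hy, if_pos (by exact hr), hd, smul_smul, hyr, wCoord_ofInfinity,
    xCoord_eq_inv, zCoord_ofInfinity]
  congr 1
  simp only [Polynomial.eval_pow, Polynomial.eval_X, Polynomial.eval_neg]
  rw [hj, pow_add, pow_add]
  simp only [inv_pow]
  field_simp

theorem monomialForm_ofInfinity (j : Fin g) {r : AffineCurve D.fInf} (hr : r.y ≠ 0) :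
    monomialForm j (ofInfinity r) =
      sheetForm D.fInf (-Polynomial.X ^ (g - 1 - j : ℕ)) zCoord wCoord (ofInfinity r) := by
  unfold monomialForm
  split_ifs with h
  · obtain ⟨q, hq⟩ := h
    exact sheetForm_eq_of_glued j (ofAffine_eq_ofInfinity.1 hq) hr
  · rfl

/-- A zero at the origin of a nonsingular polynomial is isolated. -/
theorem eventually_fInf_ne_zero : ∀ᶠ t in 𝓝 (0 : ℂ), t ≠ 0 → D.fInf.eval t ≠ 0 := by
  by_cases h0 : D.fInf.eval 0 = 0
  · exact eventually_nhdsWithin_iff.1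
      ((D.fInf.hasDerivAt 0).eventually_ne (D.nonsingular_fInf 0 h0))
  · exact (D.fInf.continuous.continuousAt.eventually_ne h0).mono fun _ h _ => h

theorem holomorphicFormAt_monomialForm (j : Fin g) (P : D.Curve) :
    HolomorphicFormAt (monomialForm j) P := by
  by_cases hP : P ∈ Set.range (ofAffine : AffineCurve D.f → D.Curve)
  · obtain ⟨q, rfl⟩ := hP
    exact (holomorphicFormAt_sheetForm (Polynomial.X ^ (j : ℕ)) D.nonsingular_f
      (eventually_ofAffine contMDiffAt_xCoord q) (eventually_ofAffine contMDiffAt_yCoord q)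
      (eventually_ofAffine (fun q => q.eqn) q)).congr
      (eventually_ofAffine (monomialForm_ofAffine j) q)
  · obtain ⟨r, rfl⟩ := (exists_rep P).resolve_left hP
    refine (holomorphicFormAt_sheetForm (-Polynomial.X ^ (g - 1 - j : ℕ)) D.nonsingular_fInf
      (eventually_ofInfinity contMDiffAt_zCoord r) (eventually_ofInfinity contMDiffAt_wCoord r)
      (eventually_ofInfinity (fun q => q.eqn) r)).congr ?_
    -- a point of the second affine curve which is missed by the first one has `z = 0`
    have hr0 : zCoord (ofInfinity r) = 0 := by
      by_contra h0
      change r.x ≠ 0 at h0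
      refine hP ⟨⟨r.x⁻¹, r.y * r.x⁻¹ ^ (g + 1), ?_⟩, ofAffine_eq_ofInfinity.2
        ⟨inv_mul_cancel₀ h0, rfl⟩⟩
      rw [D.eval_f_inv h0, ← r.eqn, mul_pow, ← pow_mul]
      ring
    have hev : ∀ᶠ Q in 𝓝 (ofInfinity r), zCoord Q ≠ 0 → D.fInf.eval (zCoord Q) ≠ 0 :=
      (contMDiffAt_zCoord r).continuousAt.eventually (p := fun t => t ≠ 0 → D.fInf.eval t ≠ 0)
        (by rw [hr0]; exact eventually_fInf_ne_zero)
    filter_upwards [hev, isOpenEmbedding_ofInfinity.isOpen_range.mem_nhds ⟨r, rfl⟩] with Q hQ hQr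
    obtain ⟨r', rfl⟩ := hQr
    unfold monomialForm
    split_ifs with h
    · obtain ⟨q, hq⟩ := h
      have hg := ofAffine_eq_ofInfinity.1 hq
      refine sheetForm_eq_of_glued j hg fun hy => hQ hg.ne_zero ?_
      rw [zCoord_ofInfinity, ← r'.eqn, hy]
      simp
    · rfl

/-- The holomorphic one-form `x ^ j dx / y`. -/
def monomialSection (j : Fin g) : HolomorphicOneForm D.Curve where
  toFun := monomialForm j
  contMDiff_toFun := holomorphicFormAt_monomialForm j

theorem monomialSection_ofAffine (j : Fin g) {q : AffineCurve D.f} (hq : q.y ≠ 0)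
    (v : TangentSpace 𝓘(ℂ) (ofAffine q)) :
    (monomialSection j (ofAffine q) v : ℂ) =
      q.x ^ (j : ℕ) / q.y * differential (xCoord : D.Curve → ℂ) (ofAffine q) v := by
  change (monomialForm j (ofAffine q) v : ℂ) = _
  rw [monomialForm_ofAffine, sheetForm, if_pos (by exact hq)]
  simp [xCoord_ofAffine, yCoord_ofAffine]

theorem monomialSection_ofInfinity (j : Fin g) {r : AffineCurve D.fInf} (hr : r.y ≠ 0)
    (v : TangentSpace 𝓘(ℂ) (ofInfinity r)) :
    (monomialSection j (ofInfinity r) v : ℂ) =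
      -r.x ^ (g - 1 - j : ℕ) / r.y * differential (zCoord : D.Curve → ℂ) (ofInfinity r) v := by
  change (monomialForm j (ofInfinity r) v : ℂ) = _
  rw [monomialForm_ofInfinity j hr, sheetForm, if_pos (by exact hr)]
  simp [zCoord_ofInfinity, wCoord_ofInfinity]

/-! ### The charts away from the Weierstrass points -/

theorem affineChart_ofAffine {q : AffineCurve D.f} (hq : q.y ≠ 0) (q' : AffineCurve D.f) :
    affineChart q (ofAffine q') = q'.x := by
  rw [affineChart_apply, AffineCurve.chart, dif_pos hq]
  rfl

theorem infinityChart_ofInfinity {r : AffineCurve D.fInf} (hr : r.y ≠ 0)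
    (r' : AffineCurve D.fInf) : infinityChart r (ofInfinity r') = r'.x := by
  rw [infinityChart_apply, AffineCurve.chart, dif_pos hr]
  rfl

theorem exists_affineChart_symm {q : AffineCurve D.f} (hq : q.y ≠ 0) {z : ℂ}
    (hz : z ∈ (affineChart q).target) :
    ∃ q' : AffineCurve D.f, (affineChart q).symm z = ofAffine q' ∧ q'.x = z := by
  refine ⟨_, affineChart_symm_apply q z, ?_⟩
  rw [← affineChart_ofAffine hq, ← affineChart_symm_apply, (affineChart q).right_inv hz]

theorem exists_infinityChart_symm {r : AffineCurve D.fInf} (hr : r.y ≠ 0) {z : ℂ}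
    (hz : z ∈ (infinityChart r).target) :
    ∃ r' : AffineCurve D.fInf, (infinityChart r).symm z = ofInfinity r' ∧ r'.x = z := by
  refine ⟨_, infinityChart_symm_apply r z, ?_⟩
  rw [← infinityChart_ofInfinity hr, ← infinityChart_symm_apply, (infinityChart r).right_inv hz]

theorem chartAt_ofAffine (q : AffineCurve D.f) : chartAt ℂ (ofAffine q) = affineChart q := by
  have h : ∃ q', ofAffine q' = ofAffine q := ⟨q, rfl⟩
  change preferredChart (ofAffine q) = _
  rw [preferredChart, dif_pos h, ofAffine_injective h.choose_spec]

theorem chartAt_ofInfinity {P : D.Curve} (hP : ¬ ∃ q, ofAffine q = P) :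
    ∃ r : AffineCurve D.fInf, ofInfinity r = P ∧ chartAt ℂ P = infinityChart r := by
  refine ⟨_, ((exists_rep P).resolve_left hP).choose_spec, ?_⟩
  change preferredChart P = _
  rw [preferredChart, dif_neg hP]

theorem differential_xCoord_chart {q : AffineCurve D.f} (hq : q.y ≠ 0) {z : ℂ}
    (hz : z ∈ (affineChart q).target) :
    differential (xCoord : D.Curve → ℂ) ((affineChart q).symm z)
      (mfderiv 𝓘(ℂ) 𝓘(ℂ) (affineChart q).symm z (1 : ℂ)) = (1 : ℂ) := by
  refine differential_mfderiv_symm (affineChart_mem_atlas q) hz ?_ fun w hw => ?_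
  · rw [affineChart_symm_apply]
    exact contMDiffAt_xCoord _
  · obtain ⟨q', h1, h2⟩ := exists_affineChart_symm hq hw
    rw [h1, xCoord_ofAffine, h2]

theorem differential_zCoord_chart {r : AffineCurve D.fInf} (hr : r.y ≠ 0) {z : ℂ}
    (hz : z ∈ (infinityChart r).target) :
    differential (zCoord : D.Curve → ℂ) ((infinityChart r).symm z)
      (mfderiv 𝓘(ℂ) 𝓘(ℂ) (infinityChart r).symm z (1 : ℂ)) = (1 : ℂ) := by
  refine differential_mfderiv_symm (infinityChart_mem_atlas r) hz ?_ fun w hw => ?_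
  · rw [infinityChart_symm_apply]
    exact contMDiffAt_zCoord _
  · obtain ⟨q', h1, h2⟩ := exists_infinityChart_symm hr hw
    rw [h1, zCoord_ofInfinity, h2]

end HyperellipticDatum.Curve

/-! ### Nondegeneracy of the canonical curve -/

section MatrixCurve

variable {g : ℕ}

/-- The polynomial curve with components `∑ⱼ aⱼᵢ X ^ j`. -/
def matrixCurve (A : Matrix (Fin g) (Fin g) ℂ) (i : Fin g) : ℂ[X] :=
  ∑ j : Fin g, Polynomial.C (A j i) * Polynomial.X ^ (j : ℕ)

theorem eval_matrixCurve (A : Matrix (Fin g) (Fin g) ℂ) (i : Fin g) (z : ℂ) :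
    (matrixCurve A i).eval z = ∑ j : Fin g, A j i * z ^ (j : ℕ) := by
  simp [matrixCurve, Polynomial.eval_finsetSum]

theorem coeff_matrixCurve (A : Matrix (Fin g) (Fin g) ℂ) (i j : Fin g) :
    (matrixCurve A i).coeff j = A j i := by
  simp only [matrixCurve, Polynomial.finsetSum_coeff, Polynomial.coeff_C_mul,
    Polynomial.coeff_X_pow, Fin.val_inj]
  simp

theorem curveDeriv_matrixCurve (A : Matrix (Fin g) (Fin g) ℂ) (k : ℕ) (z : ℂ) :
    curveDeriv (matrixCurve A) k z =
      A.vecMulLinear fun j => curveDeriv (fun j : Fin g => Polynomial.X ^ (j : ℕ)) k z j := by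
  ext i
  simp only [curveDeriv, matrixCurve, Polynomial.iterate_derivative_sum,
    Polynomial.iterate_derivative_C_mul, Polynomial.eval_finsetSum, Polynomial.eval_mul,
    Polynomial.eval_C, Matrix.vecMulLinear_apply, Matrix.vecMul, dotProduct]
  exact Finset.sum_congr rfl fun j _ => mul_comm _ _

/-- The rational normal curve and its first two derivatives are independent: this is read off
from the components `1`, `X`, `X²`. -/
theorem linearIndependent_curveDeriv_X_pow (hg : 2 < g) (z : ℂ) :
    LinearIndependent ℂ fun k : Fin 3 =>
      curveDeriv (fun j : Fin g => (Polynomial.X : ℂ[X]) ^ (j : ℕ)) k z := by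
  rw [Fintype.linearIndependent_iff]
  intro c hc
  have h0 := congrFun hc ⟨0, by omega⟩
  have h1 := congrFun hc ⟨1, by omega⟩
  have h2 := congrFun hc ⟨2, hg⟩
  simp [Fin.sum_univ_three, curveDeriv] at h0 h1 h2
  simp only [h0, zero_mul, zero_add] at h1 h2
  simp only [h1, zero_mul, zero_add] at h2
  intro k
  fin_cases k
  · exact h0
  · exact h1
  · simpa using h2

theorem linearIndependent_curveDeriv_matrixCurve (hg : 2 < g) {A : Matrix (Fin g) (Fin g) ℂ}
    (hA : IsUnit A) (z : ℂ) :
    LinearIndependent ℂ fun k : Fin 3 => curveDeriv (matrixCurve A) k z := by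
  simp only [curveDeriv_matrixCurve]
  exact (linearIndependent_curveDeriv_X_pow hg z).map' A.vecMulLinear
    (LinearMap.ker_eq_bot.2 (Matrix.vecMul_injective_of_isUnit hA))

theorem gramDet_matrixCurve_pos (hg : 2 < g) {A : Matrix (Fin g) (Fin g) ℂ}
    (hA : IsUnit A) {n : ℕ} (hn : n ≤ 3) (z : ℂ) : 0 < gramDet (matrixCurve A) n z :=
  gramDet_pos _ ((linearIndependent_curveDeriv_matrixCurve hg hA z).comp (Fin.castLE hn)
    (Fin.castLE_injective hn))

theorem curveDeriv_matrixCurve_zero (A : Matrix (Fin g) (Fin g) ℂ) (k i : Fin g) :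
    curveDeriv (matrixCurve A) k 0 i = (k : ℕ).factorial * A k i := by
  rw [curveDeriv, ← Polynomial.coeff_zero_eq_eval_zero, Polynomial.coeff_iterate_derivative,
    zero_add, coeff_matrixCurve, Nat.descFactorial_self, nsmul_eq_mul]

theorem derivInner_matrixCurve_zero (A : Matrix (Fin g) (Fin g) ℂ) (k l : Fin g) :
    derivInner (matrixCurve A) k l 0 =
      (k : ℕ).factorial * (l : ℕ).factorial * (A * A.conjTranspose) k l := by
  simp only [derivInner, curveDeriv_matrixCurve_zero, Matrix.mul_apply, Finset.mul_sum,
    Matrix.conjTranspose_apply, map_mul, map_natCast, RCLike.star_def]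
  exact Finset.sum_congr rfl fun i _ => by ring

theorem gramDet_two_matrixCurve_zero (hg : 2 < g) (A : Matrix (Fin g) (Fin g) ℂ) :
    (gramDet (matrixCurve A) 2 0 : ℂ) =
      (leadingSubmatrix (A * A.conjTranspose) 2 hg.le).det := by
  have h : derivGram (matrixCurve A) 2 0 = leadingSubmatrix (A * A.conjTranspose) 2 hg.le := by
    ext k l
    refine (derivInner_matrixCurve_zero A (Fin.castLE hg.le k) (Fin.castLE hg.le l)).trans ?_
    fin_cases k <;> fin_cases l <;> simp [leadingSubmatrix]
  rw [ofReal_gramDet, h]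

theorem gramDet_three_matrixCurve_zero (hg : 2 < g) (A : Matrix (Fin g) (Fin g) ℂ) :
    (gramDet (matrixCurve A) 3 0 : ℂ) =
      4 * (leadingSubmatrix (A * A.conjTranspose) 3 hg).det := by
  have h : ∀ k l : Fin 3, derivInner (matrixCurve A) k l 0 =
      (k : ℕ).factorial * (l : ℕ).factorial *
        leadingSubmatrix (A * A.conjTranspose) 3 hg k l :=
    fun k l => derivInner_matrixCurve_zero A (Fin.castLE hg k) (Fin.castLE hg l)
  rw [ofReal_gramDet, Matrix.det_fin_three, Matrix.det_fin_three]
  simp only [derivGram, Matrix.of_apply, h]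
  simp
  ring

/-- The matrix of coefficients of the one-forms in the coordinate `z = 1 / x`. -/
def reverseMatrix (A : Matrix (Fin g) (Fin g) ℂ) : Matrix (Fin g) (Fin g) ℂ :=
  -A.submatrix Fin.revPerm (Equiv.refl _)

theorem isUnit_reverseMatrix {A : Matrix (Fin g) (Fin g) ℂ} (hA : IsUnit A) :
    IsUnit (reverseMatrix A) :=
  ((Matrix.isUnit_submatrix_equiv _ _).2 hA).neg

theorem eval_reverseMatrix (A : Matrix (Fin g) (Fin g) ℂ) (i : Fin g) (z : ℂ) :
    (matrixCurve (reverseMatrix A) i).eval z =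
      ∑ j : Fin g, A j i * -z ^ (g - 1 - j : ℕ) := by
  rw [eval_matrixCurve]
  refine Fintype.sum_equiv Fin.revPerm _ _ fun j => ?_
  have hj : g - 1 - (Fin.rev j : ℕ) = j := by rw [Fin.val_rev]; omega
  simp only [Fin.revPerm_apply, hj]
  simp [reverseMatrix]

theorem eval_reverseMatrix_eq (A : Matrix (Fin g) (Fin g) ℂ) (i : Fin g) {z : ℂ} (hz : z ≠ 0) :
    (matrixCurve (reverseMatrix A) i).eval z =
      -z ^ (g - 1) * (matrixCurve A i).eval z⁻¹ := by
  rw [eval_reverseMatrix, eval_matrixCurve, Finset.mul_sum]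
  refine Finset.sum_congr rfl fun j _ => ?_
  have hj : g - 1 = (g - 1 - j) + j := by omega
  nth_rw 2 [hj]
  rw [pow_add, inv_pow]
  field_simp

theorem curveDeriv_zero_reverseMatrix (A : Matrix (Fin g) (Fin g) ℂ) {z : ℂ} (hz : z ≠ 0)
    (i : Fin g) : curveDeriv (matrixCurve (reverseMatrix A)) 0 z i =
      -z ^ (g - 1) * curveDeriv (matrixCurve A) 0 z⁻¹ i :=
  eval_reverseMatrix_eq A i hz

theorem curveDeriv_one_reverseMatrix (hg : 2 < g) (A : Matrix (Fin g) (Fin g) ℂ) {z : ℂ}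
    (hz : z ≠ 0) (i : Fin g) : curveDeriv (matrixCurve (reverseMatrix A)) 1 z i =
      -(g - 1 : ℕ) * z ^ (g - 2) * curveDeriv (matrixCurve A) 0 z⁻¹ i +
        z ^ (g - 3) * curveDeriv (matrixCurve A) 1 z⁻¹ i := by
  -- Differentiate `-z ^ (g - 1) p(1 / z)` and compare.
  have h1 := (hasDerivAt_curveDeriv (matrixCurve (reverseMatrix A)) 0 z i)
  have h2 := ((hasDerivAt_pow (g - 1) z).neg).mul
    ((hasDerivAt_curveDeriv (matrixCurve A) 0 z⁻¹ i).comp z (hasDerivAt_inv hz))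
  have h3 := h2.congr_of_eventuallyEq
    (f₁ := fun w => curveDeriv (matrixCurve (reverseMatrix A)) 0 w i)
    (Filter.mem_of_superset (isOpen_ne.mem_nhds hz)
      fun w hw => curveDeriv_zero_reverseMatrix A hw i)
  rw [h1.unique h3]
  obtain ⟨n, rfl⟩ : ∃ n, g = n + 3 := ⟨g - 3, by omega⟩
  simp
  field_simp
  ring

theorem gramDet_one_reverseMatrix (A : Matrix (Fin g) (Fin g) ℂ) {z : ℂ} (hz : z ≠ 0) :
    gramDet (matrixCurve (reverseMatrix A)) 1 z =
      ‖z‖ ^ (2 * (g - 1)) * gramDet (matrixCurve A) 1 z⁻¹ := by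
  rw [← Complex.ofReal_inj]
  push_cast
  rw [ofReal_gramDet_one, ofReal_gramDet_one, pow_mul, ← Complex.mul_conj', derivInner,
    derivInner, Finset.mul_sum]
  simp only [curveDeriv_zero_reverseMatrix A hz, map_mul, map_neg, map_pow, mul_pow]
  exact Finset.sum_congr rfl fun i _ => by ring

theorem derivInner_linear {ι : Type*} [Fintype ι] {p r : ι → ℂ[X]} {z w a b c d : ℂ} {k l : ℕ}
    (hk : ∀ i, curveDeriv r k z i = a * curveDeriv p 0 w i + b * curveDeriv p 1 w i)
    (hl : ∀ i, curveDeriv r l z i = c * curveDeriv p 0 w i + d * curveDeriv p 1 w i) :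
    derivInner r k l z = a * (starRingEnd ℂ) c * derivInner p 0 0 w +
      a * (starRingEnd ℂ) d * derivInner p 0 1 w + b * (starRingEnd ℂ) c * derivInner p 1 0 w +
      b * (starRingEnd ℂ) d * derivInner p 1 1 w := by
  simp only [derivInner, Finset.mul_sum, ← Finset.sum_add_distrib, hk, hl, map_add, map_mul]
  exact Finset.sum_congr rfl fun i _ => by ring

/-- Modulo `p`, the derivative of `-z ^ (g - 1) p(1 / z)` is `z ^ (g - 3) p'(1 / z)`, so the
`2 × 2` Gram determinant is multiplied by `|z ^ (g - 1) z ^ (g - 3)|²`. -/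
theorem gramDet_two_reverseMatrix (hg : 2 < g) (A : Matrix (Fin g) (Fin g) ℂ) {z : ℂ}
    (hz : z ≠ 0) : gramDet (matrixCurve (reverseMatrix A)) 2 z =
      ‖z‖ ^ (2 * (g - 1 + (g - 3))) * gramDet (matrixCurve A) 2 z⁻¹ := by
  rw [← Complex.ofReal_inj]
  push_cast
  have h0 : ∀ i, curveDeriv (matrixCurve (reverseMatrix A)) 0 z i =
      -z ^ (g - 1) * curveDeriv (matrixCurve A) 0 z⁻¹ i +
        0 * curveDeriv (matrixCurve A) 1 z⁻¹ i :=
    fun i => by rw [curveDeriv_zero_reverseMatrix A hz]; ring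
  have h1 := curveDeriv_one_reverseMatrix hg A hz
  rw [ofReal_gramDet_two, ofReal_gramDet_two, pow_mul, ← Complex.mul_conj',
    derivInner_linear h0 h0, derivInner_linear h0 h1, derivInner_linear h1 h0,
    derivInner_linear h1 h1]
  simp only [map_neg, map_pow, map_mul, map_zero, map_natCast, mul_pow, pow_add]
  ring

end MatrixCurve

/-! ### The canonical metric of the hyperelliptic curve -/

/-- Evaluation of holomorphic one-forms at a tangent vector. -/
def evalForm {M : Type*} [TopologicalSpace M] [ChartedSpace ℂ M] [IsManifold 𝓘(ℂ) ω M] (P : M)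
    (v : TangentSpace 𝓘(ℂ) P) : HolomorphicOneForm M →ₗ[ℂ] ℂ where
  toFun s := s P v
  map_add' _ _ := rfl
  map_smul' _ _ := rfl

/-- The canonical metric is `|p|² / |q|` on tangent vectors on which the forms take the values
`pᵢ / y`, where `y² = q`. -/
theorem canonicalMetric_self_re {M : Type*} [TopologicalSpace M] [ChartedSpace ℂ M]
    [IsManifold 𝓘(ℂ) ω M] {ι : Type*} [Fintype ι] {η : ι → HolomorphicOneForm M} {P : M}
    {v : TangentSpace 𝓘(ℂ) P} {p : ι → ℂ[X]} {q : ℂ[X]} {y z : ℂ} (hy : y ^ 2 = q.eval z)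
    (h : ∀ i, (η i P v : ℂ) = (p i).eval z / y) :
    (canonicalMetric η P v v).re = gramDet p 1 z / ‖q.eval z‖ := by
  have h1 : canonicalMetric η P v v = ((gramDet p 1 z / ‖q.eval z‖ : ℝ) : ℂ) := by
    push_cast
    rw [ofReal_gramDet_one, ← hy, norm_pow, Complex.ofReal_pow, ← Complex.mul_conj',
      canonicalMetric, derivInner, Finset.sum_div]
    refine Finset.sum_congr rfl fun i _ => ?_
    rw [h i, map_div₀, div_mul_div_comm]
    rfl
  rw [h1, Complex.ofReal_re]

namespace HyperellipticDatum.Curve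

variable {g : ℕ} {D : HyperellipticDatum g}

theorem exists_differential_xCoord_eq_one {q : AffineCurve D.f} (hq : q.y ≠ 0) :
    ∃ v : TangentSpace 𝓘(ℂ) (ofAffine q),
      differential (xCoord : D.Curve → ℂ) (ofAffine q) v = (1 : ℂ) := by
  have hs := mem_affineChart_source q
  have h : ∃ v : TangentSpace 𝓘(ℂ) ((affineChart q).symm (affineChart q (ofAffine q))),
      differential (xCoord : D.Curve → ℂ) _ v = (1 : ℂ) :=
    ⟨_, differential_xCoord_chart hq ((affineChart q).map_source hs)⟩
  rwa [(affineChart q).left_inv hs] at h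

theorem exists_point_of_eval_ne_zero {x : ℂ} (hx : D.f.eval x ≠ 0) :
    ∃ q : AffineCurve D.f, q.x = x ∧ q.y ≠ 0 := by
  obtain ⟨y, hy⟩ := IsAlgClosed.exists_pow_nat_eq (D.f.eval x) (n := 2) (by norm_num)
  refine ⟨⟨x, y, hy⟩, rfl, fun h => hx ?_⟩
  change y = 0 at h
  rw [← hy, h]
  simp

/-- A relation between the forms `x ^ j dx / y` makes a polynomial of degree less than `g` vanish
wherever `f ≠ 0`, so its product with `f` is zero. -/
theorem linearIndependent_monomialSection :
    LinearIndependent ℂ (monomialSection : Fin g → HolomorphicOneForm D.Curve) := by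
  rw [Fintype.linearIndependent_iff]
  intro c hc
  have key : (∑ j : Fin g, Polynomial.C (c j) * Polynomial.X ^ (j : ℕ)) * D.f = 0 := by
    refine Polynomial.funext fun x => ?_
    rw [Polynomial.eval_mul, Polynomial.eval_zero]
    by_cases hx : D.f.eval x = 0
    · rw [hx, mul_zero]
    obtain ⟨q, rfl, hq⟩ := exists_point_of_eval_ne_zero hx
    obtain ⟨v, hv⟩ := exists_differential_xCoord_eq_one hq
    have h := congrArg (evalForm (ofAffine q) v) hc
    rw [map_sum, map_zero] at h
    have h2 : ∀ j : Fin g, evalForm (ofAffine q) v (c j • monomialSection j) =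
        c j * q.x ^ (j : ℕ) / q.y := by
      intro j
      rw [map_smul, smul_eq_mul, mul_div_assoc]
      congr 1
      refine (monomialSection_ofAffine j hq v).trans ?_
      rw [hv, mul_one]
    simp only [h2, ← Finset.sum_div, div_eq_zero_iff, hq, or_false] at h
    simp [Polynomial.eval_finsetSum, h]
  have h0 := (mul_eq_zero.1 key).resolve_right D.separable.ne_zero
  intro j
  have := congrArg (fun p => p.coeff (j : ℕ)) h0
  simpa only [Polynomial.finsetSum_coeff, Polynomial.coeff_C_mul, Polynomial.coeff_X_pow,
    Fin.val_inj, mul_ite, mul_one, mul_zero, Finset.sum_ite_eq, Finset.mem_univ, if_true,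
    Polynomial.coeff_zero] using this

variable (η : Module.Basis (Fin g) ℂ (HolomorphicOneForm D.Curve))

/-- The forms `x ^ j dx / y`, `j < g`, as a basis of the holomorphic one-forms: they are
independent, and the basis `η` fixes the dimension. -/
def monomialBasis : Module.Basis (Fin g) ℂ (HolomorphicOneForm D.Curve) :=
  haveI : Module.Finite ℂ (HolomorphicOneForm D.Curve) := .of_basis η
  Module.Basis.mk linearIndependent_monomialSection
    (LinearIndependent.span_eq_top_of_card_eq_finrank' linearIndependent_monomialSection
      (Module.finrank_eq_card_basis η).symm).ge

/-- The matrix `A` with `ηᵢ = ∑ⱼ aⱼᵢ x ^ j dx / y`. -/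
def coeffMatrix : Matrix (Fin g) (Fin g) ℂ := (monomialBasis η).toMatrix η

theorem isUnit_coeffMatrix : IsUnit (coeffMatrix η) :=
  .of_mul_eq_one _ ((monomialBasis η).toMatrix_mul_toMatrix_flip η)

theorem basis_apply (i : Fin g) (P : D.Curve) (v : TangentSpace 𝓘(ℂ) P) :
    (η i P v : ℂ) = ∑ j, coeffMatrix η j i * (monomialSection j P v : ℂ) := by
  have h := congrArg (evalForm P v) ((monomialBasis η).sum_toMatrix_smul_self η i).symm
  simp only [map_sum, map_smul, smul_eq_mul, monomialBasis, Module.Basis.mk_apply] at h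
  exact h

theorem basis_ofAffine (i : Fin g) {q : AffineCurve D.f} (hq : q.y ≠ 0)
    (v : TangentSpace 𝓘(ℂ) (ofAffine q)) :
    (η i (ofAffine q) v : ℂ) = (matrixCurve (coeffMatrix η) i).eval q.x / q.y *
      differential (xCoord : D.Curve → ℂ) (ofAffine q) v := by
  rw [basis_apply, eval_matrixCurve, Finset.sum_div, Finset.sum_mul]
  refine Finset.sum_congr rfl fun j _ => ?_
  rw [monomialSection_ofAffine j hq]
  ring

theorem basis_ofInfinity (i : Fin g) {r : AffineCurve D.fInf} (hr : r.y ≠ 0)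
    (v : TangentSpace 𝓘(ℂ) (ofInfinity r)) :
    (η i (ofInfinity r) v : ℂ) =
      (matrixCurve (reverseMatrix (coeffMatrix η)) i).eval r.x / r.y *
        differential (zCoord : D.Curve → ℂ) (ofInfinity r) v := by
  rw [basis_apply, eval_reverseMatrix, Finset.sum_div, Finset.sum_mul]
  refine Finset.sum_congr rfl fun j _ => ?_
  rw [monomialSection_ofInfinity j hr]
  ring

theorem conformalFactor_affineChart {q : AffineCurve D.f} (hq : q.y ≠ 0) {z : ℂ}
    (hz : z ∈ (affineChart q).target) (hf : D.f.eval z ≠ 0) :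
    conformalFactor (canonicalMetric fun i => η i) (affineChart q) z =
      gramDet (matrixCurve (coeffMatrix η)) 1 z / ‖D.f.eval z‖ := by
  obtain ⟨q', h1, h2⟩ := exists_affineChart_symm hq hz
  have hq' : q'.y ≠ 0 := fun h => hf (by rw [← h2, ← q'.eqn, h]; simp)
  refine canonicalMetric_self_re (y := q'.y) (by rw [q'.eqn, h2]) fun i => ?_
  have key := differential_xCoord_chart hq hz
  -- The type of the tangent vector depends on the point, so the vector is generalized before the
  -- point is rewritten.
  generalize mfderiv 𝓘(ℂ) 𝓘(ℂ) (affineChart q).symm z (1 : ℂ) = v at key ⊢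
  revert v
  rw [h1]
  intro v hv
  rw [basis_ofAffine η i hq', hv, mul_one, h2]

theorem conformalFactor_infinityChart {r : AffineCurve D.fInf} (hr : r.y ≠ 0) {z : ℂ}
    (hz : z ∈ (infinityChart r).target) (hf : D.fInf.eval z ≠ 0) :
    conformalFactor (canonicalMetric fun i => η i) (infinityChart r) z =
      gramDet (matrixCurve (reverseMatrix (coeffMatrix η))) 1 z / ‖D.fInf.eval z‖ := by
  obtain ⟨q', h1, h2⟩ := exists_infinityChart_symm hr hz
  have hq' : q'.y ≠ 0 := fun h => hf (by rw [← h2, ← q'.eqn, h]; simp)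
  refine canonicalMetric_self_re (y := q'.y) (by rw [q'.eqn, h2]) fun i => ?_
  have key := differential_zCoord_chart hr hz
  -- The type of the tangent vector depends on the point, so the vector is generalized before the
  -- point is rewritten.
  generalize mfderiv 𝓘(ℂ) 𝓘(ℂ) (infinityChart r).symm z (1 : ℂ) = v at key ⊢
  revert v
  rw [h1]
  intro v hv
  rw [basis_ofInfinity η i hq', hv, mul_one, h2]

theorem eval_f_ne_zero {q : AffineCurve D.f} (hq : q.y ≠ 0) : D.f.eval q.x ≠ 0 := by
  rw [← q.eqn]
  exact pow_ne_zero 2 hq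

theorem eval_fInf_ne_zero {r : AffineCurve D.fInf} (hr : r.y ≠ 0) : D.fInf.eval r.x ≠ 0 := by
  rw [← r.eqn]
  exact pow_ne_zero 2 hr

theorem mem_affineChart_target {q : AffineCurve D.f} (hq : q.y ≠ 0) :
    q.x ∈ (affineChart q).target := by
  rw [← affineChart_ofAffine hq]
  exact (affineChart q).map_source (mem_affineChart_source q)

theorem mem_infinityChart_target {r : AffineCurve D.fInf} (hr : r.y ≠ 0) :
    r.x ∈ (infinityChart r).target := by
  rw [← infinityChart_ofInfinity hr]
  exact (infinityChart r).map_source (mem_infinityChart_source r)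

theorem eventually_conformalFactor_affineChart {q : AffineCurve D.f} (hq : q.y ≠ 0) :
    ∀ᶠ z in 𝓝 q.x, conformalFactor (canonicalMetric fun i => η i) (affineChart q) z =
      gramDet (matrixCurve (coeffMatrix η)) 1 z / ‖D.f.eval z‖ := by
  filter_upwards [(affineChart q).open_target.mem_nhds (mem_affineChart_target hq),
    eventually_eval_ne_zero (eval_f_ne_zero hq)] with z hz hf
  exact conformalFactor_affineChart η hq hz hf

variable (hg : 2 < g)
include hg

theorem gaussianCurvature_ofAffine {q : AffineCurve D.f} (hq : q.y ≠ 0) :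
    gaussianCurvature (canonicalMetric fun i => η i) (ofAffine q) =
      -(2 * ‖D.f.eval q.x‖ * gramDet (matrixCurve (coeffMatrix η)) 2 q.x /
        gramDet (matrixCurve (coeffMatrix η)) 1 q.x ^ 3) := by
  have hx : chartAt ℂ (ofAffine q) (ofAffine q) = q.x := by
    rw [chartAt_ofAffine, affineChart_ofAffine hq]
  have h := gaussianCurvature_eq (h := canonicalMetric fun i => η i) (P := ofAffine q)
    (gramDet_matrixCurve_pos hg (isUnit_coeffMatrix η) (by norm_num)) (q := D.f)
    (by rw [hx]; exact eval_f_ne_zero hq)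
    (by rw [hx, chartAt_ofAffine]; exact eventually_conformalFactor_affineChart η hq)
  rwa [hx] at h

/-- The curvature at a point of the second affine curve. Where the two affine curves overlap the
preferred chart is the coordinate `x`, and the formula expresses the invariance of the curvature
under the change of coordinate `z = 1 / x`. -/
theorem gaussianCurvature_ofInfinity {r : AffineCurve D.fInf} (hr : r.y ≠ 0) :
    gaussianCurvature (canonicalMetric fun i => η i) (ofInfinity r) =
      -(2 * ‖D.fInf.eval r.x‖ * gramDet (matrixCurve (reverseMatrix (coeffMatrix η))) 2 r.x /
        gramDet (matrixCurve (reverseMatrix (coeffMatrix η))) 1 r.x ^ 3) := by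
  by_cases hP : ∃ q, ofAffine q = ofInfinity r
  · obtain ⟨q, hqr⟩ := hP
    have hG := ofAffine_eq_ofInfinity.1 hqr
    have hz := hG.ne_zero
    have hq : q.y ≠ 0 := by
      rw [hG.y_eq]
      exact mul_ne_zero hr (pow_ne_zero _ (inv_ne_zero hz))
    have hn := norm_ne_zero_iff.2 hz
    -- The powers of `|z|` cancel: `(2g + 2) + (4g - 8) - 3 (2g - 2) = 0`.
    rw [← hqr, gaussianCurvature_ofAffine η hg hq, hG.x_eq, D.eval_fInf hz,
      gramDet_one_reverseMatrix _ hz, gramDet_two_reverseMatrix hg _ hz, norm_mul, norm_pow]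
    have h1 := (gramDet_matrixCurve_pos hg (isUnit_coeffMatrix η) (n := 1) (by norm_num)
      r.x⁻¹).ne'
    obtain ⟨n, rfl⟩ : ∃ n, g = n + 3 := ⟨g - 3, by omega⟩
    have e1 : n + 3 - 1 = n + 2 := rfl
    have e2 : n + 3 - 3 = n := rfl
    rw [e1, e2]
    field_simp
    ring
  · obtain ⟨r', hr', hc⟩ := chartAt_ofInfinity hP
    obtain rfl := ofInfinity_injective hr'
    have hx : chartAt ℂ (ofInfinity r') (ofInfinity r') = r'.x := by
      rw [hc, infinityChart_ofInfinity hr]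
    have h := gaussianCurvature_eq (h := canonicalMetric fun i => η i) (P := ofInfinity r')
      (gramDet_matrixCurve_pos hg (isUnit_reverseMatrix (isUnit_coeffMatrix η)) (by norm_num))
      (q := D.fInf) (by rw [hx]; exact eval_fInf_ne_zero hr) (by
        rw [hx, hc]
        filter_upwards [(infinityChart r').open_target.mem_nhds (mem_infinityChart_target hr),
          eventually_eval_ne_zero (eval_fInf_ne_zero hr)] with z hz hf
        exact conformalFactor_infinityChart η hr hz hf)
    rwa [hx] at h

theorem log_neg_gaussianCurvature_affineChart {q : AffineCurve D.f} (hq : q.y ≠ 0) {z : ℂ}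
    (hz : z ∈ (affineChart q).target) (hf : D.f.eval z ≠ 0) :
    Real.log (-gaussianCurvature (canonicalMetric fun i => η i) ((affineChart q).symm z)) =
      logNegCurvature (matrixCurve (coeffMatrix η)) D.f z := by
  obtain ⟨q', h1, rfl⟩ := exists_affineChart_symm hq hz
  have hq' : q'.y ≠ 0 := fun h => hf (by rw [← q'.eqn, h]; simp)
  rw [h1, gaussianCurvature_ofAffine η hg hq', neg_neg, logNegCurvature]

theorem eventually_log_neg_gaussianCurvature_affineChart {q : AffineCurve D.f} (hq : q.y ≠ 0) :
    ∀ᶠ z in 𝓝 q.x,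
      Real.log (-gaussianCurvature (canonicalMetric fun i => η i) ((affineChart q).symm z)) =
        logNegCurvature (matrixCurve (coeffMatrix η)) D.f z := by
  filter_upwards [(affineChart q).open_target.mem_nhds (mem_affineChart_target hq),
    eventually_eval_ne_zero (eval_f_ne_zero hq)] with z hz hf
  exact log_neg_gaussianCurvature_affineChart η hg hq hz hf

theorem eventually_log_neg_gaussianCurvature_infinityChart {r : AffineCurve D.fInf}
    (hr : r.y ≠ 0) : ∀ᶠ z in 𝓝 r.x,
      Real.log (-gaussianCurvature (canonicalMetric fun i => η i) ((infinityChart r).symm z)) =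
        logNegCurvature (matrixCurve (reverseMatrix (coeffMatrix η))) D.fInf z := by
  filter_upwards [(infinityChart r).open_target.mem_nhds (mem_infinityChart_target hr),
    eventually_eval_ne_zero (eval_fInf_ne_zero hr)] with z hz hf
  obtain ⟨r', h1, rfl⟩ := exists_infinityChart_symm hr hz
  have hr' : r'.y ≠ 0 := fun h => hf (by rw [← r'.eqn, h]; simp)
  rw [h1, gaussianCurvature_ofInfinity η hg hr', neg_neg, logNegCurvature]

theorem meanFieldDefect_ofAffine {q : AffineCurve D.f} (hq : q.y ≠ 0) :
    meanFieldDefect (canonicalMetric fun i => η i) (ofAffine q) =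
      4 * ‖D.f.eval q.x‖ * gramDet (matrixCurve (coeffMatrix η)) 3 q.x /
        gramDet (matrixCurve (coeffMatrix η)) 2 q.x ^ 2 := by
  have hx : chartAt ℂ (ofAffine q) (ofAffine q) = q.x := by
    rw [chartAt_ofAffine, affineChart_ofAffine hq]
  have h := meanFieldDefect_eq (h := canonicalMetric fun i => η i) (P := ofAffine q)
    (gramDet_matrixCurve_pos hg (isUnit_coeffMatrix η) (by norm_num))
    (gramDet_matrixCurve_pos hg (isUnit_coeffMatrix η) (by norm_num)) (q := D.f)
    (by rw [hx]; exact eval_f_ne_zero hq)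
    (by rw [hx, chartAt_ofAffine]; exact eventually_conformalFactor_affineChart η hq)
    (by
      rw [hx, chartAt_ofAffine]
      exact eventually_log_neg_gaussianCurvature_affineChart η hg hq)
  rwa [hx] at h

theorem meanFieldDefect_ofAffine_pos {q : AffineCurve D.f} (hq : q.y ≠ 0) :
    0 < meanFieldDefect (canonicalMetric fun i => η i) (ofAffine q) := by
  rw [meanFieldDefect_ofAffine η hg hq]
  have h2 := gramDet_matrixCurve_pos hg (isUnit_coeffMatrix η) (n := 2) (by norm_num) q.x
  have h3 := gramDet_matrixCurve_pos hg (isUnit_coeffMatrix η) (n := 3) le_rfl q.x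
  have := norm_pos_iff.2 (eval_f_ne_zero hq)
  positivity

omit hg in
theorem cases_of_notMem_weierstrassPoints {P : D.Curve} (hP : P ∉ weierstrassPoints D) :
    (∃ q : AffineCurve D.f, q.y ≠ 0 ∧ ofAffine q = P) ∨
      ∃ r : AffineCurve D.fInf, r.y ≠ 0 ∧ ofInfinity r = P ∧
        chartAt ℂ P = infinityChart r := by
  by_cases h : ∃ q, ofAffine q = P
  · obtain ⟨q, rfl⟩ := h
    exact Or.inl ⟨q, fun hq => hP (Or.inl ⟨q, hq, rfl⟩), rfl⟩
  · obtain ⟨r, hr, hc⟩ := chartAt_ofInfinity h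
    exact Or.inr ⟨r, fun hy => hP (Or.inr ⟨r, hy, hr⟩), hr, hc⟩

omit hg in
theorem ofAffine_notMem_weierstrassPoints {q : AffineCurve D.f} (hq : q.y ≠ 0) :
    ofAffine q ∉ weierstrassPoints D := by
  rintro (⟨q', h, h'⟩ | ⟨r, h, h'⟩)
  · exact hq (ofAffine_injective h' ▸ h)
  · exact hq (by rw [(ofAffine_eq_ofInfinity.1 h'.symm).y_eq, h, zero_mul])

theorem gaussianCurvature_neg {P : D.Curve} (hP : P ∉ weierstrassPoints D) :
    gaussianCurvature (canonicalMetric fun i => η i) P < 0 := by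
  rcases cases_of_notMem_weierstrassPoints hP with ⟨q, hq, rfl⟩ | ⟨r, hr, rfl, -⟩
  · rw [gaussianCurvature_ofAffine η hg hq, neg_lt_zero]
    have h1 := gramDet_matrixCurve_pos hg (isUnit_coeffMatrix η) (n := 1) (by norm_num) q.x
    have h2 := gramDet_matrixCurve_pos hg (isUnit_coeffMatrix η) (n := 2) (by norm_num) q.x
    have := norm_pos_iff.2 (eval_f_ne_zero hq)
    positivity
  · have hA := isUnit_reverseMatrix (isUnit_coeffMatrix η)
    rw [gaussianCurvature_ofInfinity η hg hr, neg_lt_zero]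
    have h1 := gramDet_matrixCurve_pos hg hA (n := 1) (by norm_num) r.x
    have h2 := gramDet_matrixCurve_pos hg hA (n := 2) (by norm_num) r.x
    have := norm_pos_iff.2 (eval_fInf_ne_zero hr)
    positivity

omit hg in
/-- Smoothness over `ℝ` at a point of a complex manifold of dimension one can be checked in the
preferred chart. -/
theorem contMDiffAt_real_of_chart {M : Type*} [TopologicalSpace M] [ChartedSpace ℂ M]
    {u : M → ℝ} {F : ℂ → ℝ} {P : M}
    (h : ∀ᶠ z in 𝓝 (chartAt ℂ P P), u ((chartAt ℂ P).symm z) = F z)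
    (hF : ContDiffAt ℝ ∞ F (chartAt ℂ P P)) : ContMDiffAt 𝓘(ℝ, ℂ) 𝓘(ℝ, ℝ) ∞ u P := by
  have hs := mem_chart_source ℂ P
  rw [contMDiffAt_iff]
  constructor
  · have hc : ContinuousAt (fun Q => F (chartAt ℂ P Q)) P :=
      hF.continuousAt.comp ((chartAt ℂ P).continuousAt hs)
    refine hc.congr ?_
    filter_upwards [((chartAt ℂ P).continuousAt hs).eventually h,
      (chartAt ℂ P).open_source.mem_nhds hs] with Q hQ hQs
    rw [← hQ, (chartAt ℂ P).left_inv hQs]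
  · refine (hF.congr_of_eventuallyEq ?_).contDiffWithinAt
    exact h

theorem contMDiffOn_log_neg_gaussianCurvature :
    ContMDiffOn 𝓘(ℝ, ℂ) 𝓘(ℝ, ℝ) ∞
      (fun P : D.Curve => Real.log (-gaussianCurvature (canonicalMetric fun i => η i) P))
      (weierstrassPoints D)ᶜ := by
  intro P hP
  refine ContMDiffAt.contMDiffWithinAt ?_
  rcases cases_of_notMem_weierstrassPoints hP with ⟨q, hq, rfl⟩ | ⟨r, hr, rfl, hc⟩
  · have hx : chartAt ℂ (ofAffine q) (ofAffine q) = q.x := by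
      rw [chartAt_ofAffine, affineChart_ofAffine hq]
    refine contMDiffAt_real_of_chart (F := logNegCurvature (matrixCurve (coeffMatrix η)) D.f) ?_ ?_
    · rw [hx, chartAt_ofAffine]
      exact eventually_log_neg_gaussianCurvature_affineChart η hg hq
    · rw [hx]
      exact contDiffAt_logNegCurvature
        (gramDet_matrixCurve_pos hg (isUnit_coeffMatrix η) (by norm_num))
        (gramDet_matrixCurve_pos hg (isUnit_coeffMatrix η) (by norm_num)) (eval_f_ne_zero hq)
  · have hA := isUnit_reverseMatrix (isUnit_coeffMatrix η)
    have hx : chartAt ℂ (ofInfinity r) (ofInfinity r) = r.x := by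
      rw [hc, infinityChart_ofInfinity hr]
    refine contMDiffAt_real_of_chart
      (F := logNegCurvature (matrixCurve (reverseMatrix (coeffMatrix η))) D.fInf) ?_ ?_
    · rw [hx, hc]
      exact eventually_log_neg_gaussianCurvature_infinityChart η hg hr
    · rw [hx]
      exact contDiffAt_logNegCurvature (gramDet_matrixCurve_pos hg hA (by norm_num))
        (gramDet_matrixCurve_pos hg hA (by norm_num)) (eval_fInf_ne_zero hr)

end HyperellipticDatum.Curve

/-! ### Failure of the mean field equation -/

section Green

variable {u φ : ℂ → ℝ}

theorem laplacian_eq_fderiv_fderiv {z : ℂ} (h : ContDiffAt ℝ 2 u z) :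
    Laplacian.laplacian u z = fderiv ℝ (fun w => fderiv ℝ u w 1) z 1 +
      fderiv ℝ (fun w => fderiv ℝ u w Complex.I) z Complex.I := by
  have hd : DifferentiableAt ℝ (fderiv ℝ u) z :=
    (h.fderiv_right (m := 1) (by norm_num)).differentiableAt (by norm_num)
  have key : ∀ v : ℂ, fderiv ℝ (fun w => fderiv ℝ u w v) z v = fderiv ℝ (fderiv ℝ u) z v v := by
    intro v
    rw [fderiv_clm_apply hd (differentiableAt_const v)]
    simp
  rw [InnerProductSpace.laplacian_eq_iteratedFDeriv_complexPlane, key, key]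
  simp [iteratedFDeriv_two_apply]

theorem laplacian_eq_zero_of_notMem_tsupport {z : ℂ} (hz : z ∉ tsupport φ) :
    Laplacian.laplacian φ z = 0 := by
  have h : φ =ᶠ[𝓝 z] fun _ => (0 : ℝ) := notMem_tsupport_iff_eventuallyEq.1 hz
  rw [(InnerProductSpace.laplacian_congr_nhds h).self_of_nhds]
  simp

theorem integrable_mul_of_tsupport_subset {a b : ℂ → ℝ} (hφ : HasCompactSupport φ)
    (ha : ∀ z ∈ tsupport φ, ContinuousAt a z) (hb : Continuous b)
    (hs : tsupport b ⊆ tsupport φ) : MeasureTheory.Integrable fun z => a z * b z := by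
  have hbs : HasCompactSupport b := hφ.of_isClosed_subset (isClosed_tsupport b) hs
  refine Continuous.integrable_of_hasCompactSupport ?_ hbs.mul_left
  refine continuous_of_tsupport fun z hz => ?_
  exact (ha z (hs (tsupport_mul_subset_right hz))).mul hb.continuousAt

theorem integral_mul_fderiv_fderiv (hφ : ContDiff ℝ ∞ φ) (hc : HasCompactSupport φ)
    (hu : ∀ z ∈ tsupport φ, ContDiffAt ℝ 2 u z) (v : ℂ) :
    ∫ z, u z * fderiv ℝ (fun w => fderiv ℝ φ w v) z v =
      ∫ z, fderiv ℝ (fun w => fderiv ℝ u w v) z v * φ z := by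
  have h1 : ContDiff ℝ ∞ fun w => fderiv ℝ φ w v :=
    (hφ.fderiv_right (m := ∞) (by simp)).clm_apply contDiff_const
  have h2 : ContDiff ℝ ∞ fun z => fderiv ℝ (fun w => fderiv ℝ φ w v) z v :=
    (h1.fderiv_right (m := ∞) (by simp)).clm_apply contDiff_const
  have s1 : tsupport (fun w => fderiv ℝ φ w v) ⊆ tsupport φ := tsupport_fderiv_apply_subset ℝ v
  have s2 : tsupport (fun z => fderiv ℝ (fun w => fderiv ℝ φ w v) z v) ⊆ tsupport φ :=
    (tsupport_fderiv_apply_subset ℝ v).trans s1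
  have u1 : ∀ z ∈ tsupport φ, ContDiffAt ℝ 1 (fun w => fderiv ℝ u w v) z := fun z hz =>
    ((hu z hz).fderiv_right (m := 1) (by norm_num)).clm_apply contDiffAt_const
  have u2 : ∀ z ∈ tsupport φ, ContDiffAt ℝ 0 (fun z => fderiv ℝ (fun w => fderiv ℝ u w v) z v) z :=
    fun z hz => ((u1 z hz).fderiv_right (m := 0) (by norm_num)).clm_apply contDiffAt_const
  have c0 := fun z hz => (hu z hz).continuousAt
  have c1 := fun z hz => (u1 z hz).continuousAt
  have c2 := fun z hz => (u2 z hz).continuousAt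
  rw [integral_mul_fderiv_eq_neg_fderiv_mul_of_integrable
      (integrable_mul_of_tsupport_subset hc c1 h1.continuous s1)
      (integrable_mul_of_tsupport_subset hc c0 h2.continuous s2)
      (integrable_mul_of_tsupport_subset hc c0 h1.continuous s1)
      (fun z hz => (hu z (s1 hz)).differentiableAt (by norm_num))
      (fun z _ => h1.contDiffAt.differentiableAt (by simp)),
    integral_mul_fderiv_eq_neg_fderiv_mul_of_integrable
      (integrable_mul_of_tsupport_subset hc c2 hφ.continuous subset_rfl)
      (integrable_mul_of_tsupport_subset hc c1 h1.continuous s1)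
      (integrable_mul_of_tsupport_subset hc c1 hφ.continuous subset_rfl)
      (fun z hz => (u1 z hz).differentiableAt (by norm_num))
      (fun z _ => hφ.contDiffAt.differentiableAt (by simp)), neg_neg]

/-- Green's second identity for a test function `φ` and a function `u` that is only assumed to be
smooth near the support of `φ`. -/
theorem integral_mul_laplacian (hφ : ContDiff ℝ ∞ φ) (hc : HasCompactSupport φ)
    (hu : ∀ z ∈ tsupport φ, ContDiffAt ℝ ∞ u z) :
    ∫ z, u z * Laplacian.laplacian φ z = ∫ z, Laplacian.laplacian u z * φ z := by
  have hu2 : ∀ z ∈ tsupport φ, ContDiffAt ℝ 2 u z := fun z hz => contDiffAt_infty.1 (hu z hz) 2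
  have hL : ∀ z, Laplacian.laplacian u z * φ z =
      fderiv ℝ (fun w => fderiv ℝ u w 1) z 1 * φ z +
        fderiv ℝ (fun w => fderiv ℝ u w Complex.I) z Complex.I * φ z := by
    intro z
    by_cases hz : z ∈ tsupport φ
    · rw [laplacian_eq_fderiv_fderiv (hu2 z hz), add_mul]
    · simp [image_eq_zero_of_notMem_tsupport hz]
  have hR : ∀ z, u z * Laplacian.laplacian φ z =
      u z * fderiv ℝ (fun w => fderiv ℝ φ w 1) z 1 +
        u z * fderiv ℝ (fun w => fderiv ℝ φ w Complex.I) z Complex.I := by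
    intro z
    rw [laplacian_eq_fderiv_fderiv (contDiff_infty.1 hφ 2).contDiffAt, mul_add]
  have i1 : ∀ v : ℂ, MeasureTheory.Integrable fun z =>
      u z * fderiv ℝ (fun w => fderiv ℝ φ w v) z v := by
    intro v
    have h1 : ContDiff ℝ ∞ fun w => fderiv ℝ φ w v :=
      (hφ.fderiv_right (m := ∞) (by simp)).clm_apply contDiff_const
    have h2 : ContDiff ℝ ∞ fun z => fderiv ℝ (fun w => fderiv ℝ φ w v) z v :=
      (h1.fderiv_right (m := ∞) (by simp)).clm_apply contDiff_const
    exact integrable_mul_of_tsupport_subset hc (fun z hz => (hu z hz).continuousAt) h2.continuous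
      ((tsupport_fderiv_apply_subset ℝ v).trans (tsupport_fderiv_apply_subset ℝ v))
  have i2 : ∀ v : ℂ, MeasureTheory.Integrable fun z =>
      fderiv ℝ (fun w => fderiv ℝ u w v) z v * φ z := by
    intro v
    refine integrable_mul_of_tsupport_subset hc (fun z hz => ?_) hφ.continuous subset_rfl
    have u1 : ContDiffAt ℝ 1 (fun w => fderiv ℝ u w v) z :=
      ((hu2 z hz).fderiv_right (m := 1) (by norm_num)).clm_apply contDiffAt_const
    exact ((u1.fderiv_right (m := 0) (by norm_num)).clm_apply contDiffAt_const).continuousAt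
  simp only [hL, hR]
  rw [MeasureTheory.integral_add (i1 1) (i1 _), MeasureTheory.integral_add (i2 1) (i2 _),
    integral_mul_fderiv_fderiv hφ hc hu2, integral_mul_fderiv_fderiv hφ hc hu2]

/-- Two functions that vanish off `K ⊆ s` and agree on `K` have the same integral, the one taken
over `s` and the other over the plane. -/
theorem setIntegral_eq_integral_of_subset {s K : Set ℂ} (hs : MeasurableSet s) (hK : K ⊆ s)
    {G H : ℂ → ℝ} (h1 : ∀ z ∈ K, G z = H z) (h2 : ∀ z ∉ K, G z = 0 ∧ H z = 0) :
    ∫ z in s, G z = ∫ z, H z := by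
  rw [← MeasureTheory.integral_indicator hs]
  congr 1
  ext z
  by_cases hz : z ∈ K
  · rw [Set.indicator_of_mem (hK hz), h1 z hz]
  · rw [(h2 z hz).2]
    by_cases hzs : z ∈ s
    · rw [Set.indicator_of_mem hzs, (h2 z hz).1]
    · rw [Set.indicator_of_notMem hzs]

end Green

namespace HyperellipticDatum.Curve

variable {g : ℕ} {D : HyperellipticDatum g}

theorem exists_affine_point : ∃ q : AffineCurve D.f, q.y ≠ 0 := by
  obtain ⟨x, hx⟩ : ∃ x, D.f.eval x ≠ 0 := by
    by_contra! h
    exact D.separable.ne_zero (Polynomial.funext fun x => by rw [h x, Polynomial.eval_zero])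
  obtain ⟨q, -, hq⟩ := exists_point_of_eval_ne_zero hx
  exact ⟨q, hq⟩

theorem eval_affineChart_weierstrass {q : AffineCurve D.f} (hq : q.y ≠ 0) {P : D.Curve}
    (hP : P ∈ weierstrassPoints D) (hs : P ∈ (affineChart q).source) :
    D.f.eval (affineChart q P) = 0 := by
  rw [affineChart_source] at hs
  obtain ⟨q', -, rfl⟩ := hs
  rw [affineChart_ofAffine hq]
  by_contra h
  exact ofAffine_notMem_weierstrassPoints (fun h0 => h (by rw [← q'.eqn, h0]; simp)) hP

/-- Tested against a bump function near a point with `y ≠ 0`, the mean field equation says that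
the integral of the positive function `Φ` times the area form against the bump function
vanishes. -/
theorem not_satisfiesMeanFieldEquation (hg : 2 < g)
    (η : Module.Basis (Fin g) ℂ (HolomorphicOneForm D.Curve)) :
    ¬ SatisfiesMeanFieldEquation (canonicalMetric fun i => η i) 6 (weierstrassPoints D)
      fun P => Real.log (-gaussianCurvature (canonicalMetric fun i => η i) P) := by
  intro hM
  obtain ⟨q, hq⟩ := exists_affine_point (D := D)
  set p := matrixCurve (coeffMatrix η) with hp
  have w1 : ∀ z, 0 < gramDet p 1 z :=
    gramDet_matrixCurve_pos hg (isUnit_coeffMatrix η) (by norm_num)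
  have w2 : ∀ z, 0 < gramDet p 2 z :=
    gramDet_matrixCurve_pos hg (isUnit_coeffMatrix η) (by norm_num)
  have w3 : ∀ z, 0 < gramDet p 3 z :=
    gramDet_matrixCurve_pos hg (isUnit_coeffMatrix η) le_rfl
  have c1 := (contDiff_gramDet p 1).continuous
  have c2 := (contDiff_gramDet p 2).continuous
  have c3 := (contDiff_gramDet p 3).continuous
  obtain ⟨R, hR, hball⟩ := Metric.nhds_basis_closedBall.mem_iff.1
    (Filter.inter_mem ((affineChart q).open_target.mem_nhds (mem_affineChart_target hq))
      (eventually_eval_ne_zero (eval_f_ne_zero hq)))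
  let φ : ContDiffBump q.x := ⟨R / 2, R, half_pos hR, half_lt_self hR⟩
  have hφs : tsupport φ = Metric.closedBall q.x R := φ.tsupport_eq
  have hφt : tsupport φ ⊆ (affineChart q).target := fun z hz => (hball (hφs ▸ hz)).1
  have hφf : ∀ z ∈ tsupport φ, D.f.eval z ≠ 0 := fun z hz => (hball (hφs ▸ hz)).2
  have hφ0 : ∀ z ∉ tsupport φ, φ z = 0 := fun z hz => image_eq_zero_of_notMem_tsupport hz
  obtain ⟨-, -, hM⟩ := hM _ (affineChart_mem_atlas q) φ φ.contDiff φ.hasCompactSupport hφt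
  rw [finsum_mem_eq_zero_of_forall_eq_zero fun P hP => hφ0 _ fun h =>
    hφf _ h (eval_affineChart_weierstrass hq hP.1 hP.2), mul_zero] at hM
  have hmeas := (affineChart q).open_target.measurableSet
  have e1 := setIntegral_eq_integral_of_subset hmeas hφt
    (G := fun z => Real.log (-gaussianCurvature (canonicalMetric fun i => η i)
      ((affineChart q).symm z)) * (Laplacian.laplacian (φ : ℂ → ℝ) : ℂ → ℝ) z)
    (H := fun z => logNegCurvature p D.f z * (Laplacian.laplacian (φ : ℂ → ℝ) : ℂ → ℝ) z)
    (fun z hz => by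
      rw [log_neg_gaussianCurvature_affineChart η hg hq (hφt hz) (hφf z hz)])
    (fun z hz => by simp [laplacian_eq_zero_of_notMem_tsupport hz])
  have e2 := setIntegral_eq_integral_of_subset hmeas hφt
    (G := fun z => Real.exp (Real.log (-gaussianCurvature (canonicalMetric fun i => η i)
      ((affineChart q).symm z))) * φ z *
        conformalFactor (canonicalMetric fun i => η i) (affineChart q) z)
    (H := fun z => 2 * gramDet p 2 z / gramDet p 1 z ^ 2 * φ z)
    (fun z hz => by
      have h0 := norm_pos_iff.2 (hφf z hz)
      have h1 := w1 z
      have h2 := w2 z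
      rw [log_neg_gaussianCurvature_affineChart η hg hq (hφt hz) (hφf z hz),
        conformalFactor_affineChart η hq (hφt hz) (hφf z hz), ← hp, logNegCurvature,
        Real.exp_log (by positivity)]
      field_simp)
    (fun z hz => by simp [hφ0 z hz])
  have e3 := integral_mul_laplacian φ.contDiff φ.hasCompactSupport fun z hz =>
    contDiffAt_logNegCurvature w1 w2 (hφf z hz)
  have e4 : ∀ z, Laplacian.laplacian (logNegCurvature p D.f) z * φ z =
      4 * (gramDet p 1 z * gramDet p 3 z) / gramDet p 2 z ^ 2 * φ z -
        6 * (2 * gramDet p 2 z / gramDet p 1 z ^ 2 * φ z) := by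
    intro z
    by_cases hz : z ∈ tsupport φ
    · rw [laplacian_logNegCurvature w1 w2 (hφf z hz)]
      ring
    · simp [hφ0 z hz]
  have k1 : Continuous fun z => 4 * (gramDet p 1 z * gramDet p 3 z) / gramDet p 2 z ^ 2 * φ z :=
    ((continuous_const.mul (c1.mul c3)).div (c2.pow 2) fun z => (pow_pos (w2 z) 2).ne').mul
      φ.continuous
  have k2 : Continuous fun z => 2 * gramDet p 2 z / gramDet p 1 z ^ 2 * φ z :=
    ((continuous_const.mul c2).div (c1.pow 2) fun z => (pow_pos (w1 z) 2).ne').mul φ.continuous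
  have s1 : HasCompactSupport fun z =>
      4 * (gramDet p 1 z * gramDet p 3 z) / gramDet p 2 z ^ 2 * φ z :=
    φ.hasCompactSupport.mul_left
  have s2 : HasCompactSupport fun z => 2 * gramDet p 2 z / gramDet p 1 z ^ 2 * φ z :=
    φ.hasCompactSupport.mul_left
  -- The curvature terms cancel, and the integral of `4 W₁ W₃ / W₂² φ` remains.
  rw [e1, e2, e3, MeasureTheory.integral_congr_ae (Filter.Eventually.of_forall e4),
    MeasureTheory.integral_sub (k1.integrable_of_hasCompactSupport s1)
      ((k2.integrable_of_hasCompactSupport s2).const_mul 6),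
    MeasureTheory.integral_const_mul, sub_add_cancel] at hM
  refine (k1.integral_pos_of_hasCompactSupport_nonneg_nonzero s1 (fun z => ?_)
    (x := q.x) ?_).ne' hM
  · have h1 := w1 z
    have h2 := w2 z
    have h3 := w3 z
    have := φ.nonneg' z
    positivity
  · have h1 := w1 q.x
    have h2 := w2 q.x
    have h3 := w3 q.x
    have := φ.pos_of_mem_ball (Metric.mem_ball_self φ.rOut_pos)
    positivity

end HyperellipticDatum.Curve

end

theorem mainTheorem8 (g : ℕ) (hg : 2 < g) (D : HyperellipticDatum g)
    (η : Module.Basis (Fin g) ℂ (HolomorphicOneForm D.Curve)) :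
    let ds2 := canonicalMetric (fun i => η i)
    let u : D.Curve → ℝ := fun P => Real.log (-gaussianCurvature ds2 P)
    let Z := HyperellipticDatum.Curve.weierstrassPoints D
    let Φ : D.Curve → ℝ := meanFieldDefect ds2
    -- away from the Weierstrass points `u = log (-K)`, and hence `Φ`, is well defined
    (∀ P ∉ Z, gaussianCurvature ds2 P < 0) ∧
    ContMDiffOn 𝓘(ℝ, ℂ) 𝓘(ℝ, ℝ) ∞ u Zᶜ ∧
    -- `Φ` does not vanish identically
    (∃ P ∉ Z, Φ P ≠ 0) ∧
    -- the value of `Φ` at the points with `x = 0`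
    (∃ A : Matrix (Fin g) (Fin g) ℂ, IsUnit A ∧
      (∀ (i : Fin g) (q : AffineCurve D.f), q.y ≠ 0 →
        ∀ v : TangentSpace 𝓘(ℂ) (HyperellipticDatum.Curve.ofAffine q),
          (η i (HyperellipticDatum.Curve.ofAffine q) v : ℂ) =
            (∑ j : Fin g, A j i * q.x ^ (j : ℕ)) / q.y *
              HyperellipticDatum.Curve.dx (HyperellipticDatum.Curve.ofAffine q) v) ∧
      ∀ q : AffineCurve D.f, q.x = 0 → q.y ≠ 0 →
        ((Φ (HyperellipticDatum.Curve.ofAffine q) : ℝ) : ℂ) =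
          16 * (‖D.f.eval 0‖ : ℂ) * (leadingSubmatrix (A * A.conjTranspose) 3 hg).det /
            (leadingSubmatrix (A * A.conjTranspose) 2 hg.le).det ^ 2 ∧
        0 < Φ (HyperellipticDatum.Curve.ofAffine q)) ∧
    -- `u` does not satisfy the mean field equation `Δu + 6 e^u = 4π ∑_{P ∈ Z} δ_P`
    ¬ SatisfiesMeanFieldEquation ds2 6 Z u := by
  intro ds2 u Z Φ
  refine ⟨fun P hP => HyperellipticDatum.Curve.gaussianCurvature_neg η hg hP,
    HyperellipticDatum.Curve.contMDiffOn_log_neg_gaussianCurvature η hg, ?_,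
    ⟨HyperellipticDatum.Curve.coeffMatrix η, HyperellipticDatum.Curve.isUnit_coeffMatrix η,
      fun i q hq v => ?_, fun q hx hq =>
        ⟨?_, HyperellipticDatum.Curve.meanFieldDefect_ofAffine_pos η hg hq⟩⟩,
    HyperellipticDatum.Curve.not_satisfiesMeanFieldEquation hg η⟩
  · obtain ⟨q, hq⟩ := HyperellipticDatum.Curve.exists_affine_point (D := D)
    exact ⟨_, HyperellipticDatum.Curve.ofAffine_notMem_weierstrassPoints hq,
      (HyperellipticDatum.Curve.meanFieldDefect_ofAffine_pos η hg hq).ne'⟩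
  · rw [HyperellipticDatum.Curve.basis_ofAffine η i hq, eval_matrixCurve]
    rfl
  · change ((meanFieldDefect (canonicalMetric fun i => η i) _ : ℝ) : ℂ) = _
    rw [HyperellipticDatum.Curve.meanFieldDefect_ofAffine η hg hq, hx]
    push_cast
    rw [gramDet_three_matrixCurve_zero hg, gramDet_two_matrixCurve_zero hg]
    ring
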